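/- On a region of $\mathbb{R}^5$ with coordinates $(x_1,x_2,\psi_0,\psi_1,\psi_2)$ let $X_\mu=X_\mu(x_\mu)$ and $N_\mu=N_\mu(x_\mu)$ ($\mu=1,2$) be functions of one variable, let $\nu\neq\mu$ denote the other index, and put $$U_\mu=x_\mu-x_\nu,\quad Q_\mu=\frac{X_\mu}{U_\mu},\quad \theta_\mu=d\psi_1+x_\nu\,d\psi_2,\quad A=\sum_{\mu=1}^2\frac{N_\mu}{U_\mu}\,\theta_\mu .$$ On the open set $D$ where $x_1\ne x_2$ and $Q_1,Q_2>0$, let $$g_\pm=\sum_{\mu=1}^2\frac{dx_\mu^2}{Q_\mu}+\sum_{\mu=1}^2Q_\mu\theta_\mu^2\pm 4\big(d\psi_0+(x_1+x_2)d\psi_1+x_1x_2\,d\psi_2+A\big)^2 ,$$ a Riemannian metric for the sign $+$ (the Sasaki-with-torsion metric for $n=2$) and a Lorentzian metric for the sign $-$, with orthonormal coframe $e^\mu=dx_\mu/\sqrt{Q_\mu}$, $\hat e^\mu=\sqrt{Q_\mu}\,\theta_\mu$, $e^0=2(d\psi_0+(x_1+x_2)d\psi_1+x_1x_2d\psi_2+A)$,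 and the orientation in which $e^1\wedge\hat e^1\wedge e^2\wedge\hat e^2\wedge e^0$ is positive. For constants $c_F,q_1,q_2$ put $A_{(1)}=c_F\sum_{\mu}\frac{q_\mu}{U_\mu}\theta_\mu$ and $F=dA_{(1)}$. The field equations of five-dimensional minimal supergravity with cosmological constant $\Lambda$ ($\Lambda=-12$: gauged; $\Lambda=0$: ungauged) are $$R_{ab}=\epsilon\Big[\tfrac{\Lambda}{3}g_{ab}+\tfrac12\big(F_{ac}F_b{}^c-\tfrac16g_{ab}F_{cd}F^{cd}\big)\Big],\qquad d{*F}-\tfrac1{\sqrt3}F\wedge F=0,$$ with $\epsilon=1$ in Lorentzian signature and $\epsilon=-1$ in Euclidean signature. Then, for all real constants $c_1,c_2,b_1,b_2,q_1,q_2,a_1$: 1. If $X_\mu=-4x_\mu^3+c_2x_\mu^2+c_1x_\mu+b_\mu-8q_\mu x_\mu$, $N_\mu=q_\mu$ and $c_F=-2\sqrt3$, then $(g_+,A_{(1)})$ solves the Euclidean gauged equations on $D$. 2. Conversely, let $N_\mu=q_\mu$, let $J_1,J_2$ be nonempty open intervals, let $X_\mu$ be $C^2$ on $J_\mu$ and suppose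 that $x_1\neq x_2$ and $Q_1,Q_2>0$ whenever $x_1\in J_1$, $x_2\in J_2$. If $(g_+,A_{(1)})$ solves the Euclidean gauged equations on $J_1\times J_2\times\mathbb{R}^3$, for some constant $c_F$, then there are constants $c_1,c_2,b_1,b_2$ with $X_\mu=-4x_\mu^3+c_2x_\mu^2+c_1x_\mu+b_\mu-8q_\mu x_\mu$ on $J_\mu$, and if $q_1\ne q_2$ then $c_F=-2\sqrt3$. 3. If $X_\mu=c_2x_\mu^2+c_1x_\mu+b_\mu$, $N_\mu=-x_\mu^2+a_1x_\mu+q_\mu$ and $c_F=-2\sqrt3$, then $(g_+,A_{(1)})$ solves the Euclidean ungauged equations on $D$. 4. If $X_\mu=4x_\mu^3+c_2x_\mu^2+c_1x_\mu+b_\mu+8q_\mu x_\mu$, $N_\mu=q_\mu$ and $c_F=-2\sqrt3$, then $(g_-,A_{(1)})$ solves the Lorentzian gauged equations on $D$. 5. If $X_\mu=c_2x_\mu^2+c_1x_\mu+b_\mu$, $N_\mu=-x_\mu^2+a_1x_\mu+q_\mu$ and $c_F=-2\sqrt3$, then $(g_-,A_{(1)})$ solves the Lorentzian ungauged equations on $D$.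 -/

import Mathlib

noncomputable section

namespace STSugra

/-! ### Tensor calculus in a coordinate chart `ι → ℝ` -/

section Calculus

variable {ι : Type*} [Fintype ι] [DecidableEq ι]

/-- The partial derivative `∂_i f` at `p`. -/
def pd (i : ι) (f : (ι → ℝ) → ℝ) (p : ι → ℝ) : ℝ :=
  deriv (fun t : ℝ => f (Function.update p i t)) (p i)

/-- Christoffel symbols `Γ^k_{ij}` of the Levi-Civita connection of the metric `g`. -/
def christoffel (g : (ι → ℝ) → Matrix ι ι ℝ) (k i j : ι) (p : ι → ℝ) : ℝ :=
  (1 / 2) * ∑ l, (g p)⁻¹ k l *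
    (pd i (fun x => g x j l) p + pd j (fun x => g x i l) p - pd l (fun x => g x i j) p)

/-- The Ricci tensor `R_{ij}`, with the sign for which round spheres have positive Ricci
curvature. -/
def ricci (g : (ι → ℝ) → Matrix ι ι ℝ) (i j : ι) (p : ι → ℝ) : ℝ :=
  ∑ k, (pd k (christoffel g k i j) p - pd j (christoffel g k i k) p +
    ∑ l, (christoffel g k k l p * christoffel g l i j p -
      christoffel g k j l p * christoffel g l i k p))

/-- A `k`-form, given by its components `ω_{I 0, …, I (k-1)}` in the coordinate basis. -/
abbrev FormField (ι : Type*) (k : ℕ) := (ι → ℝ) → (Fin k → ι) → ℝ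

/-- A covector field, as a `1`-form. -/
def oneForm (A : (ι → ℝ) → ι → ℝ) : FormField ι 1 := fun p I => A p (I 0)

/-- The exterior derivative
`(dω)_{i_0 … i_k} = ∑_m (-1)^m ∂_{i_m} ω_{i_0 … (omit i_m) … i_k}`. -/
def extD {k : ℕ} (w : FormField ι k) : FormField ι (k + 1) := fun p I =>
  ∑ m : Fin (k + 1), (-1 : ℝ) ^ (m : ℕ) * pd (I m) (fun x => w x (I ∘ m.succAbove)) p

/-- The wedge product of two `2`-forms. -/
def wedge (F G : FormField ι 2) : FormField ι 4 := fun p I =>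
  F p ![I 0, I 1] * G p ![I 2, I 3] - F p ![I 0, I 2] * G p ![I 1, I 3]
    + F p ![I 0, I 3] * G p ![I 1, I 2] + F p ![I 1, I 2] * G p ![I 0, I 3]
    - F p ![I 1, I 3] * G p ![I 0, I 2] + F p ![I 2, I 3] * G p ![I 0, I 1]

/-- `F^{ij}`: both indices of a `2`-form raised with `g`. -/
def raise (g : (ι → ℝ) → Matrix ι ι ℝ) (F : FormField ι 2) (i j : ι) (p : ι → ℝ) : ℝ :=
  ∑ k, ∑ l, (g p)⁻¹ i k * (g p)⁻¹ j l * F p ![k, l]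

/-- The contraction `F_{kl} F^{kl}`. -/
def normSq (g : (ι → ℝ) → Matrix ι ι ℝ) (F : FormField ι 2) (p : ι → ℝ) : ℝ :=
  ∑ k, ∑ l, F p ![k, l] * raise g F k l p

/-- The contraction `F_{ik} F_j{}^k`. -/
def contr (g : (ι → ℝ) → Matrix ι ι ℝ) (F : FormField ι 2) (i j : ι) (p : ι → ℝ) : ℝ :=
  ∑ k, ∑ l, (g p)⁻¹ k l * F p ![i, k] * F p ![j, l]

/-- The `5`-form `θ^0 ∧ θ^1 ∧ θ^2 ∧ θ^3 ∧ θ^4` of an ordered coframe `θ`. When `θ` is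
orthonormal this is the volume form of the orientation in which `θ` is positive. -/
def volForm (θ : Fin 5 → (ι → ℝ) → ι → ℝ) : FormField ι 5 := fun p I =>
  Matrix.det (Matrix.of fun a b : Fin 5 => θ a p (I b))

/-- The Hodge dual of a `2`-form in dimension five,
`(*F)_{klm} = (1/2) F^{ij} vol_{ijklm}`. -/
def hodge (g : (ι → ℝ) → Matrix ι ι ℝ) (vol : FormField ι 5) (F : FormField ι 2) :
    FormField ι 3 := fun p I =>
  (1 / 2) * ∑ i, ∑ j, raise g F i j p *
    vol p (Matrix.vecCons i (Matrix.vecCons j I))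

/-- The equations of five-dimensional minimal supergravity with cosmological constant `Λ`
(gauged: `Λ = -12`; ungauged: `Λ = 0`) on the open set `D` of the chart, for the metric `g`
and the gauge potential `A`, in the orientation of the `g`-orthonormal coframe `θ`.
The number `s` is the signature of the last leg of the coframe: `s = -1` is the Lorentzian
theory; for `s = 1` the metric is Riemannian and the right-hand side of
Einstein's equation has the opposite sign. -/
structure IsSugraSolution (s Λ : ℝ) (θ : Fin 5 → (ι → ℝ) → ι → ℝ)
    (g : (ι → ℝ) → Matrix ι ι ℝ) (A : (ι → ℝ) → ι → ℝ) (D : Set (ι → ℝ)) : Prop where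
  isOpen : IsOpen D
  contDiff_coframe : ∀ p ∈ D, ∀ a i, ContDiffAt ℝ 2 (fun x => θ a x i) p
  contDiff_potential : ∀ p ∈ D, ∀ i, ContDiffAt ℝ 2 (fun x => A x i) p
  /-- The rows of `θ` are linearly independent, hence a basis when `ι` has five elements. -/
  coframe_independent : ∀ p ∈ D, LinearIndependent ℝ fun a => θ a p
  orthonormal : ∀ p ∈ D, ∀ i j,
    g p i j = ∑ a, (![1, 1, 1, 1, s] : Fin 5 → ℝ) a * θ a p i * θ a p j
  einstein : ∀ p ∈ D, ∀ i j,
    ricci g i j p =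
      -s * ((Λ / 3) * g p i j
        + (1 / 2) * (contr g (extD (oneForm A)) i j p
          - (1 / 6) * g p i j * normSq g (extD (oneForm A)) p))
  maxwell : ∀ p ∈ D, ∀ I,
    extD (hodge g (volForm θ) (extD (oneForm A))) p I
      - (1 / √3) * wedge (extD (oneForm A)) (extD (oneForm A)) p I = 0

end Calculus

/-- Solutions of the Euclidean theory. -/
abbrev IsEuclideanSolution {ι : Type*} [Fintype ι] [DecidableEq ι] (Λ : ℝ)
    (θ : Fin 5 → (ι → ℝ) → ι → ℝ) (g : (ι → ℝ) → Matrix ι ι ℝ) (A : (ι → ℝ) → ι → ℝ)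
    (D : Set (ι → ℝ)) : Prop :=
  IsSugraSolution 1 Λ θ g A D

/-- Solutions of the Lorentzian theory. -/
abbrev IsLorentzianSolution {ι : Type*} [Fintype ι] [DecidableEq ι] (Λ : ℝ)
    (θ : Fin 5 → (ι → ℝ) → ι → ℝ) (g : (ι → ℝ) → Matrix ι ι ℝ) (A : (ι → ℝ) → ι → ℝ)
    (D : Set (ι → ℝ)) : Prop :=
  IsSugraSolution (-1) Λ θ g A D

/-! ### The Sasaki-with-torsion metrics in `2n+1` dimensions -/

/-- Labels of the coordinates: `Sum.inl μ` for `x_μ` (`μ = 1, …, n`, here indexed by `Fin n`)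
and `Sum.inr k` for `ψ_k` (`k = 0, …, n`). -/
abbrev Coord (n : ℕ) := Fin n ⊕ Fin (n + 1)

section Metric

variable {n : ℕ}

/-- The `k`-th elementary symmetric polynomial `σ^{(k)}` of all the `x_ν`. -/
def sigma (x : Fin n → ℝ) (k : ℕ) : ℝ :=
  ∑ S ∈ Finset.powersetCard k Finset.univ, ∏ ν ∈ S, x ν

/-- The `k`-th elementary symmetric polynomial `σ_μ^{(k)}` of the `x_ν`, `ν ≠ μ`. -/
def sigmaAt (x : Fin n → ℝ) (μ : Fin n) (k : ℕ) : ℝ :=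
  ∑ S ∈ Finset.powersetCard k (Finset.univ.erase μ), ∏ ν ∈ S, x ν

/-- `U_μ = ∏_{ν ≠ μ} (x_μ - x_ν)`. -/
def U (x : Fin n → ℝ) (μ : Fin n) : ℝ := ∏ ν ∈ Finset.univ.erase μ, (x μ - x ν)

/-- `Q_μ = X_μ(x_μ) / U_μ`. -/
def Q (X : Fin n → ℝ → ℝ) (x : Fin n → ℝ) (μ : Fin n) : ℝ := X μ (x μ) / U x μ

/-- The coordinates `x_μ` of a point. -/
def xs (p : Coord n → ℝ) : Fin n → ℝ := fun μ => p (Sum.inl μ)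

/-- The `1`-form `dx_μ`. -/
def dx (μ : Fin n) : Coord n → ℝ := Pi.single (Sum.inl μ) 1

/-- The `1`-form `∑_{k=1}^n σ_μ^{(k-1)} dψ_k`. -/
def baseForm (μ : Fin n) (p : Coord n → ℝ) : Coord n → ℝ :=
  Sum.elim (fun _ => 0) (Fin.cases 0 fun j : Fin n => sigmaAt (xs p) μ j)

/-- The `1`-form `A = ∑_μ (N_μ / U_μ) ∑_{k=1}^n σ_μ^{(k-1)} dψ_k`, where `N_μ = N_μ(x_μ)`. -/
def potential (N : Fin n → ℝ → ℝ) (p : Coord n → ℝ) : Coord n → ℝ := fun i =>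
  ∑ μ, N μ (xs p μ) / U (xs p) μ * baseForm μ p i

/-- The `1`-form `∑_{k=0}^n σ^{(k)} dψ_k + A`. -/
def fiberForm (N : Fin n → ℝ → ℝ) (p : Coord n → ℝ) : Coord n → ℝ := fun i =>
  Sum.elim (fun _ => 0) (fun k : Fin (n + 1) => sigma (xs p) k) i + potential N p i

/-- The metric
`∑_μ dx_μ² / Q_μ + ∑_μ Q_μ (∑_k σ_μ^{(k-1)} dψ_k)² + 4 s (∑_k σ^{(k)} dψ_k + A)²`. -/
def metricWithSign (s : ℝ) (X N : Fin n → ℝ → ℝ) (p : Coord n → ℝ) :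
    Matrix (Coord n) (Coord n) ℝ := Matrix.of fun i j =>
  (∑ μ, dx μ i * dx μ j / Q X (xs p) μ)
    + (∑ μ, Q X (xs p) μ * (baseForm μ p i * baseForm μ p j))
    + 4 * s * (fiberForm N p i * fiberForm N p j)

/-- The (Riemannian) Sasaki-with-torsion metric. -/
abbrev stMetric (X N : Fin n → ℝ → ℝ) := metricWithSign 1 X N

/-- The Lorentzian metric, in which the fibre direction is timelike. -/
abbrev lorentzMetric (X N : Fin n → ℝ → ℝ) := metricWithSign (-1) X N

/-- The region of the chart where the `x_μ` are distinct and every `Q_μ` is positive. -/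
def domain (X : Fin n → ℝ → ℝ) : Set (Coord n → ℝ) :=
  {p | Function.Injective (xs p) ∧ ∀ μ, 0 < Q X (xs p) μ}

/-- `e^μ = dx_μ / √Q_μ`. -/
def e (X : Fin n → ℝ → ℝ) (μ : Fin n) (p : Coord n → ℝ) : Coord n → ℝ := fun i =>
  dx μ i / √(Q X (xs p) μ)

/-- `ê^μ = √Q_μ ∑_{k=1}^n σ_μ^{(k-1)} dψ_k`. -/
def eHat (X : Fin n → ℝ → ℝ) (μ : Fin n) (p : Coord n → ℝ) : Coord n → ℝ := fun i =>
  √(Q X (xs p) μ) * baseForm μ p i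

/-- `e^0 = 2 (∑_{k=0}^n σ^{(k)} dψ_k + A)`. -/
def eZero (N : Fin n → ℝ → ℝ) (p : Coord n → ℝ) : Coord n → ℝ := fun i =>
  2 * fiberForm N p i

end Metric

/-- The ordered coframe `e^1, ê^1, e^2, ê^2, e^0` in dimension five. -/
def coframe (X N : Fin 2 → ℝ → ℝ) : Fin 5 → (Coord 2 → ℝ) → Coord 2 → ℝ :=
  ![e X 0, eHat X 0, e X 1, eHat X 1, eZero N]

/-- The potential `A_{(1)} = c_F ∑_μ (q_μ / U_μ) ∑_k σ_μ^{(k-1)} dψ_k`. -/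
def gaugePotential (cF : ℝ) (q : Fin 2 → ℝ) (p : Coord 2 → ℝ) : Coord 2 → ℝ := fun i =>
  cF * potential (fun μ _ => q μ) p i

end STSugra

end

open STSugra

noncomputable section

namespace STSugra

/-! ### Partial derivatives in the chart. -/

section Calculus

variable {ι : Type*} [DecidableEq ι]

/-! Write `x, y` for the two base coordinates, `u = x - y`, `θ₁ = dψ₁ + y dψ₂`, `θ₂ = dψ₁ + x dψ₂`,
`φ = e⁰ / 2` and `δ = q 0 - q 1`. Both choices of `N` are instances of `N(t) = (κ - 1) t² + a t +
q`: `κ = 1`, `a = 0` in the gauged case and `κ = 0` in the ungauged one. The quadratic part of `N`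
merges with the elementary symmetric functions and the linear part adds the closed form `a dψ₁`, so
`dφ = α dx ∧ θ₁ + β dy ∧ θ₂` with `α = κ - δ/u²` and `β = κ + δ/u²`. This is all that the curvature
sees of `N`. With the sign `s = ±1` kept as a parameter, one computation serves all five statements.

Nothing depends on `ψ`, and `g` is block diagonal. Its fibre block is diagonal in the frame `θ₁, θ₂,
φ`, whose derivatives are again combinations of the frame. Contracting with the dual frame therefore
turns every sum over indices into three or five terms, and the Ricci tensor comes out diagonal
(`ricci_eq`): one eigenvalue on `e¹, ê¹`, one on `e², ê²`, one along `e⁰`.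

The field strength is `F = f (e¹ ∧ ê¹ - e² ∧ ê²)` with `f = -c δ/u²`. Hence `F_{ac} F_b{}^c` is `f²`
times the metric on the four directions other than `e⁰`, `F² = 4 f²`, and `*F = -F ∧ e⁰`. As `F` is
closed, `d*F = -2 F ∧ dφ`, and Maxwell's equation is a multiple of `f (f - √3 (β - α))`. The field
equations thus follow from four scalar identities (`isSugraSolution_of_scalar`), which for cubic
`X_μ` reduce to conditions on coefficients (`isSugraSolution_cubic`).

For the converse, the `e⁰` component of Einstein's equation gives `c² δ² = 12 δ²`, and Maxwell's
equation picks the sign of `c`. The two remaining components are linear in the derivatives of `X_μ`.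
Their sum separates variables, `X₁'' + 24 x = X₂'' + 24 y`, so both sides are constant. Two
integrations give the cubics, and one of the equations at a single point relates their linear
coefficients. -/

theorem pd_congr {D : Set (ι → ℝ)} (hD : IsOpen D) {f h : (ι → ℝ) → ℝ} {p : ι → ℝ} (hp : p ∈ D)
    (hfh : ∀ q ∈ D, f q = h q) (i : ι) : pd i f p = pd i h p := by
  unfold pd
  apply Filter.EventuallyEq.deriv_eq
  have hc : Continuous fun t : ℝ => Function.update p i t := by fun_prop
  have : ∀ᶠ t in nhds (p i), Function.update p i t ∈ D :=
    hc.continuousAt.eventually (hD.mem_nhds (by simpa using hp))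
  filter_upwards [this] with t ht using hfh _ ht

theorem pd_const (i : ι) (c : ℝ) (p : ι → ℝ) : pd i (fun _ => c) p = 0 := by
  simp [pd]

end Calculus

section Chart

theorem pd_inr (k : Fin 3) (F : ℝ → ℝ → ℝ) (p : Coord 2 → ℝ) :
    pd (Sum.inr k : Coord 2) (fun p : Coord 2 → ℝ => F (p (Sum.inl 0)) (p (Sum.inl 1))) p = 0 := by
  simp [pd]

theorem pd_inl_zero {F : ℝ → ℝ → ℝ} {p : Coord 2 → ℝ} {F' : ℝ}
    (h : HasDerivAt (fun t => F t (p (Sum.inl 1))) F' (p (Sum.inl 0))) :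
    pd (Sum.inl 0) (fun p : Coord 2 → ℝ => F (p (Sum.inl 0)) (p (Sum.inl 1))) p = F' := by
  simpa [pd] using h.deriv

theorem pd_inl_one {F : ℝ → ℝ → ℝ} {p : Coord 2 → ℝ} {F' : ℝ}
    (h : HasDerivAt (fun t => F (p (Sum.inl 0)) t) F' (p (Sum.inl 1))) :
    pd (Sum.inl 1) (fun p : Coord 2 → ℝ => F (p (Sum.inl 0)) (p (Sum.inl 1))) p = F' := by
  simpa [pd] using h.deriv

end Chart

/-! ### The frame along the `ψ` directions and its dual -/

section Frame

/-- The quadratic polynomial `N(t) = (κ - 1) t² + a t + q`. -/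
def quad (κ a q t : ℝ) : ℝ := (κ - 1) * t ^ 2 + a * t + q

/-- The components of `dψ₁ + t dψ₂`. -/
def thetaForm (t : ℝ) (i : Fin 3) : ℝ := ![0, 1, t] i

/-- The components of `dψ₀ + (x + y) dψ₁ + x y dψ₂ + A`. -/
def phi (κ a q r x y : ℝ) (i : Fin 3) : ℝ :=
  ![1, x + y, x * y] i
    + (quad κ a q x * thetaForm y i - quad κ a r y * thetaForm x i) / (x - y)

/-- The vector dual to `thetaForm y` in the frame `thetaForm y, thetaForm x, phi`. -/
def dualOne (κ a q x y : ℝ) (i : Fin 3) : ℝ :=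
  ![-(x ^ 2 + quad κ a q x) / (x - y), x / (x - y), -1 / (x - y)] i

/-- The vector dual to `thetaForm x` in the frame `thetaForm y, thetaForm x, phi`. -/
def dualTwo (κ a r x y : ℝ) (i : Fin 3) : ℝ :=
  ![(y ^ 2 + quad κ a r y) / (x - y), -y / (x - y), 1 / (x - y)] i

/-- The vector `∂/∂ψ₀`. -/
def dualZero (i : Fin 3) : ℝ := ![1, 0, 0] i

variable {κ a q r x y : ℝ}

/-- Duality of the two frames, packaged so that a contraction of any covector with any vector is
read off from their coefficients. It holds for arbitrary values of `N` at the two points, hence the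
generalizations in the proof. -/
theorem sum_frame_mul_dual (hxy : x - y ≠ 0) (A B C P Q R : ℝ) :
    ∑ c, (A * thetaForm y c + B * thetaForm x c + C * phi κ a q r x y c)
      * (P * dualOne κ a q x y c + Q * dualTwo κ a r x y c + R * dualZero c)
      = A * P + B * Q + C * R := by
  simp only [Fin.sum_univ_three, thetaForm, phi, dualOne, dualTwo, dualZero, Matrix.cons_val]
  generalize quad κ a q x = M
  generalize quad κ a r y = N
  field_simp
  ring

theorem frame_complete (hxy : x - y ≠ 0) (i j : Fin 3) :
    thetaForm y i * dualOne κ a q x y j + thetaForm x i * dualTwo κ a r x y j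
      + phi κ a q r x y i * dualZero j = if i = j then 1 else 0 := by
  simp only [thetaForm, phi, dualOne, dualTwo, dualZero]
  generalize quad κ a q x = M
  generalize quad κ a r y = N
  fin_cases i <;> fin_cases j <;> simp <;> field_simp <;> ring

/-- The derivative is just `dψ₂`; it is written as a combination of the frame so that later
derivatives never leave the frame. -/
theorem hasDerivAt_thetaForm_y (hxy : x - y ≠ 0) (i : Fin 3) :
    HasDerivAt (fun t => thetaForm t i) ((thetaForm x i - thetaForm y i) / (x - y)) y := by
  fin_cases i <;> simp [thetaForm, hasDerivAt_const]
  rw [div_self hxy]; exact hasDerivAt_id y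

theorem hasDerivAt_thetaForm_x (hxy : x - y ≠ 0) (i : Fin 3) :
    HasDerivAt (fun t => thetaForm t i) ((thetaForm x i - thetaForm y i) / (x - y)) x := by
  fin_cases i <;> simp [thetaForm, hasDerivAt_const]
  rw [div_self hxy]; exact hasDerivAt_id x

theorem hasDerivAt_quad (t : ℝ) : HasDerivAt (quad κ a q) (2 * (κ - 1) * t + a) t := by
  have h := ((((hasDerivAt_id t).pow 2).const_mul (κ - 1)).add
    ((hasDerivAt_id t).const_mul a)).add_const q
  refine h.congr_deriv ?_
  simp; ring

/-- Only `thetaForm y` survives: the `a` terms of `phi` add up to the constant covector `a dψ₁`, and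
the quadratic terms of `N` change the coefficient of the symmetric functions from `1` to `κ`. -/
theorem hasDerivAt_phi_x (hxy : x - y ≠ 0) (i : Fin 3) :
    HasDerivAt (fun t => phi κ a q r t y i) ((κ - (q - r) / (x - y) ^ 2) * thetaForm y i) x := by
  have h0 : HasDerivAt (fun t => ![1, t + y, t * y] i) (thetaForm y i) x := by
    fin_cases i <;> simp [thetaForm, hasDerivAt_const]
    · exact (hasDerivAt_id' x)
    · simpa using (hasDerivAt_id x).mul_const y
  have h := h0.add ((((hasDerivAt_quad (κ := κ) (a := a) (q := q) x).mul_const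
    (thetaForm y i)).sub ((hasDerivAt_thetaForm_x hxy i).const_mul (quad κ a r y))).div
    ((hasDerivAt_id x).sub_const y) hxy)
  refine h.congr_deriv ?_
  simp only [quad, id, Pi.sub_apply]
  field_simp
  ring

theorem hasDerivAt_phi_y (hxy : x - y ≠ 0) (i : Fin 3) :
    HasDerivAt (fun t => phi κ a q r x t i) ((κ + (q - r) / (x - y) ^ 2) * thetaForm x i) y := by
  have h0 : HasDerivAt (fun t => ![1, x + t, x * t] i) (thetaForm x i) y := by
    fin_cases i <;> simp [thetaForm, hasDerivAt_const]
    · exact (hasDerivAt_id y).const_add x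
    · simpa using (hasDerivAt_id y).const_mul x
  have h := h0.add ((((hasDerivAt_thetaForm_y hxy i).const_mul (quad κ a q x)).sub
    ((hasDerivAt_quad (κ := κ) (a := a) (q := r) y).mul_const (thetaForm x i))).div
    ((hasDerivAt_id y).const_sub x) hxy)
  refine h.congr_deriv ?_
  simp only [quad, id, Pi.sub_apply]
  field_simp
  ring

end Frame

/-! ### Components of the metric and of its inverse. -/

section MetricComponents

variable (X : Fin 2 → ℝ → ℝ) (N : Fin 2 → ℝ → ℝ) (p : Coord 2 → ℝ)

theorem U_zero : U (xs p) 0 = p (Sum.inl 0) - p (Sum.inl 1) := by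
  have h : (Finset.univ.erase 0 : Finset (Fin 2)) = {1} := by decide
  simp [U, h, xs]

theorem U_one : U (xs p) 1 = -(p (Sum.inl 0) - p (Sum.inl 1)) := by
  have h : (Finset.univ.erase 1 : Finset (Fin 2)) = {0} := by decide
  simp [U, h, xs]

theorem Q_zero : Q X (xs p) 0 = X 0 (p (Sum.inl 0)) / (p (Sum.inl 0) - p (Sum.inl 1)) := by
  simp [Q, U_zero, xs]

theorem Q_one : Q X (xs p) 1 = -X 1 (p (Sum.inl 1)) / (p (Sum.inl 0) - p (Sum.inl 1)) := by
  rw [Q, U_one, xs, div_neg, neg_div]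

theorem baseForm_inl (μ ν : Fin 2) : baseForm μ p (Sum.inl ν) = 0 := rfl

theorem baseForm_zero_inr (i : Fin 3) :
    baseForm 0 p (Sum.inr i) = thetaForm (p (Sum.inl 1)) i := by
  have h : (Finset.univ.erase 0 : Finset (Fin 2)) = {1} := by decide
  have h1 : Finset.powersetCard 1 ({1} : Finset (Fin 2)) = {{1}} := by decide
  fin_cases i
  · rfl
  · change sigmaAt (xs p) 0 0 = _
    simp [sigmaAt, thetaForm]
  · change sigmaAt (xs p) 0 1 = _
    simp [sigmaAt, thetaForm, h, h1, xs]

theorem baseForm_one_inr (i : Fin 3) :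
    baseForm 1 p (Sum.inr i) = thetaForm (p (Sum.inl 0)) i := by
  have h : (Finset.univ.erase 1 : Finset (Fin 2)) = {0} := by decide
  have h1 : Finset.powersetCard 1 ({0} : Finset (Fin 2)) = {{0}} := by decide
  fin_cases i
  · rfl
  · change sigmaAt (xs p) 1 0 = _
    simp [sigmaAt, thetaForm]
  · change sigmaAt (xs p) 1 1 = _
    simp [sigmaAt, thetaForm, h, h1, xs]

theorem potential_inl (ν : Fin 2) : potential N p (Sum.inl ν) = 0 := by
  simp [potential, baseForm_inl]

theorem potential_inr (i : Fin 3) : potential N p (Sum.inr i) =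
    (N 0 (p (Sum.inl 0)) * thetaForm (p (Sum.inl 1)) i
      - N 1 (p (Sum.inl 1)) * thetaForm (p (Sum.inl 0)) i)
      / (p (Sum.inl 0) - p (Sum.inl 1)) := by
  simp only [potential, Fin.sum_univ_two, baseForm_zero_inr, baseForm_one_inr, U_zero, U_one, xs]
  rw [div_neg]; ring

theorem fiberForm_inl (ν : Fin 2) : fiberForm N p (Sum.inl ν) = 0 := by
  simp [fiberForm, potential_inl]

theorem fiberForm_inr (κ a : ℝ) (q : Fin 2 → ℝ) (i : Fin 3) :
    fiberForm (fun μ => quad κ a (q μ)) p (Sum.inr i)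
      = phi κ a (q 0) (q 1) (p (Sum.inl 0)) (p (Sum.inl 1)) i := by
  have h1 : Finset.powersetCard 1 (Finset.univ : Finset (Fin 2)) = {{0}, {1}} := by decide
  have h2 : Finset.powersetCard 2 (Finset.univ : Finset (Fin 2)) = {{0, 1}} := by decide
  rw [fiberForm, potential_inr, phi]
  congr 1
  fin_cases i
  · simp [sigma]
  · simp [sigma, h1, xs]
  · simp [sigma, h2, xs]

/-- The components of the metric along the `ψ` directions. -/
def fibreMetric (s κ a q r : ℝ) (X Y : ℝ → ℝ) (i j : Fin 3) (x y : ℝ) : ℝ :=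
  X x / (x - y) * (thetaForm y i * thetaForm y j)
    + -Y y / (x - y) * (thetaForm x i * thetaForm x j)
    + 4 * s * (phi κ a q r x y i * phi κ a q r x y j)

/-- The components of the inverse metric along the `ψ` directions. -/
def fibreInverse (s κ a q r : ℝ) (X Y : ℝ → ℝ) (i j : Fin 3) (x y : ℝ) : ℝ :=
  (x - y) / X x * (dualOne κ a q x y i * dualOne κ a q x y j)
    + -(x - y) / Y y * (dualTwo κ a r x y i * dualTwo κ a r x y j)
    + s / 4 * (dualZero i * dualZero j)

variable (s κ a : ℝ) (q : Fin 2 → ℝ)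

theorem metric_inr_inr (i j : Fin 3) :
    metricWithSign s X (fun μ => quad κ a (q μ)) p (Sum.inr i) (Sum.inr j)
      = fibreMetric s κ a (q 0) (q 1) (X 0) (X 1) i j (p (Sum.inl 0)) (p (Sum.inl 1)) := by
  simp [metricWithSign, fibreMetric, fiberForm_inr, baseForm_zero_inr, baseForm_one_inr, dx,
    Q_zero, Q_one]

theorem metric_inl_inr (μ : Fin 2) (j : Fin 3) :
    metricWithSign s X N p (Sum.inl μ) (Sum.inr j) = 0 := by
  simp [metricWithSign, fiberForm_inl, baseForm_inl, dx]

theorem metric_inr_inl (μ : Fin 2) (j : Fin 3) :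
    metricWithSign s X N p (Sum.inr j) (Sum.inl μ) = 0 := by
  simp [metricWithSign, fiberForm_inl, baseForm_inl, dx]

theorem metric_inl_inl (μ ν : Fin 2) :
    metricWithSign s X N p (Sum.inl μ) (Sum.inl ν)
      = if μ = ν then 1 / Q X (xs p) μ else 0 := by
  fin_cases μ <;> fin_cases ν <;> simp [metricWithSign, fiberForm_inl, baseForm_inl, dx]

/-- The inverse of the metric. -/
def inverseMetric : Matrix (Coord 2) (Coord 2) ℝ :=
  Matrix.fromBlocks (Matrix.diagonal fun μ => Q X (xs p) μ) 0 0
    (Matrix.of fun i j =>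
      fibreInverse s κ a (q 0) (q 1) (X 0) (X 1) i j (p (Sum.inl 0)) (p (Sum.inl 1)))

variable {X p s}

theorem sub_ne_zero_of_mem_domain (hp : p ∈ domain X) : p (Sum.inl 0) - p (Sum.inl 1) ≠ 0 :=
  sub_ne_zero.2 fun h => by simpa using hp.1 (a₁ := 0) (a₂ := 1) h

theorem zero_ne_of_mem_domain (hp : p ∈ domain X) : X 0 (p (Sum.inl 0)) ≠ 0 := by
  have := hp.2 0
  rw [Q_zero] at this
  intro h
  simp [h] at this

theorem one_ne_of_mem_domain (hp : p ∈ domain X) : X 1 (p (Sum.inl 1)) ≠ 0 := by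
  have := hp.2 1
  rw [Q_one] at this
  intro h
  simp [h] at this

/-- It suffices to check a right inverse, block by block. The fibre block is diagonal in the frame,
so its inverse is diagonal in the dual frame; `s² = 1` makes `s / 4` the inverse of `4 s`. -/
theorem metric_inv (hs : s * s = 1) (hp : p ∈ domain X) :
    (metricWithSign s X (fun μ => quad κ a (q μ)) p)⁻¹ = inverseMetric X p s κ a q := by
  have hu := sub_ne_zero_of_mem_domain hp
  have h0 := zero_ne_of_mem_domain hp
  have h1 := one_ne_of_mem_domain hp
  have hs0 : s ≠ 0 := fun h => by simp [h] at hs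
  apply Matrix.inv_eq_right_inv
  ext (μ | i) (ν | j)
  · have := (hp.2 μ).ne'
    simp [Matrix.mul_apply, inverseMetric, metric_inl_inl, Matrix.diagonal_apply, Matrix.one_apply]
    split_ifs with h
    · subst h; field_simp
    · rfl
  · simp [Matrix.mul_apply, inverseMetric, metric_inl_inr]
  · simp [Matrix.mul_apply, inverseMetric, metric_inr_inl]
  · simp only [Matrix.mul_apply, inverseMetric, Fintype.sum_sum_type, metric_inr_inl,
      Matrix.fromBlocks_apply₂₂, zero_mul, Finset.sum_const_zero, zero_add, metric_inr_inr,
      Matrix.of_apply, Matrix.one_apply, Sum.inr.injEq]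
    rw [← frame_complete (κ := κ) (a := a) (q := q 0) (r := q 1) hu i j]
    set x := p (Sum.inl 0)
    set y := p (Sum.inl 1)
    have key := sum_frame_mul_dual (κ := κ) (a := a) (q := q 0) (r := q 1) hu
      (X 0 x / (x - y) * thetaForm y i) (-X 1 y / (x - y) * thetaForm x i)
      (4 * s * phi κ a (q 0) (q 1) x y i)
      ((x - y) / X 0 x * dualOne κ a (q 0) x y j) (-(x - y) / X 1 y * dualTwo κ a (q 1) x y j)
      (s / 4 * dualZero j)
    refine (Eq.trans ?_ key).trans ?_
    · refine Finset.sum_congr rfl fun c _ => ?_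
      simp only [fibreMetric, fibreInverse]
      ring
    · field_simp
      linear_combination phi κ a (q 0) (q 1) x y i * dualZero j * hs

theorem inverseMetric_inl_inr (μ : Fin 2) (j : Fin 3) :
    inverseMetric X p s κ a q (Sum.inl μ) (Sum.inr j) = 0 := rfl

theorem inverseMetric_inr_inl (μ : Fin 2) (j : Fin 3) :
    inverseMetric X p s κ a q (Sum.inr j) (Sum.inl μ) = 0 := rfl

theorem inverseMetric_inr_inr (i j : Fin 3) :
    inverseMetric X p s κ a q (Sum.inr i) (Sum.inr j) =
      fibreInverse s κ a (q 0) (q 1) (X 0) (X 1) i j (p (Sum.inl 0)) (p (Sum.inl 1)) := rfl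

theorem inverseMetric_inl_inl (μ ν : Fin 2) :
    inverseMetric X p s κ a q (Sum.inl μ) (Sum.inl ν) =
      if μ = ν then Q X (xs p) μ else 0 := by
  simp [inverseMetric, Matrix.diagonal_apply]

end MetricComponents

/-! ### First derivatives of the fibre metric, expanded in the frame. -/

section Derivatives

variable (s κ a : ℝ) (q : Fin 2 → ℝ) (X : Fin 2 → ℝ → ℝ)

/-- The coefficient of `dx ∧ thetaForm y` in the derivative of `phi`. -/
def torsionOne (κ : ℝ) (q : Fin 2 → ℝ) (x y : ℝ) : ℝ := κ - (q 0 - q 1) / (x - y) ^ 2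

/-- The coefficient of `dy ∧ thetaForm x` in the derivative of `phi`. -/
def torsionTwo (κ : ℝ) (q : Fin 2 → ℝ) (x y : ℝ) : ℝ := κ + (q 0 - q 1) / (x - y) ^ 2

/-- The coefficient of `thetaForm y` in the `x`-derivative of the fibre metric. -/
def xRowOne (i : Fin 3) (x y : ℝ) : ℝ :=
  (deriv (X 0) x / (x - y) - X 0 x / (x - y) ^ 2) * thetaForm y i
    + X 1 y / (x - y) ^ 2 * thetaForm x i
    + 4 * s * torsionOne κ q x y * phi κ a (q 0) (q 1) x y i

/-- The coefficient of `thetaForm x` in the `x`-derivative of the fibre metric. -/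
def xRowTwo (i : Fin 3) (x y : ℝ) : ℝ :=
  X 1 y / (x - y) ^ 2 * (thetaForm y i - thetaForm x i)

/-- The coefficient of `phi` in the `x`-derivative of the fibre metric. -/
def xRowZero (i : Fin 3) (x y : ℝ) : ℝ := 4 * s * torsionOne κ q x y * thetaForm y i

/-- The coefficient of `thetaForm y` in the `y`-derivative of the fibre metric. -/
def yRowOne (i : Fin 3) (x y : ℝ) : ℝ :=
  X 0 x / (x - y) ^ 2 * (thetaForm x i - thetaForm y i)

/-- The coefficient of `thetaForm x` in the `y`-derivative of the fibre metric. -/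
def yRowTwo (i : Fin 3) (x y : ℝ) : ℝ :=
  X 0 x / (x - y) ^ 2 * thetaForm y i
    - (deriv (X 1) y / (x - y) + X 1 y / (x - y) ^ 2) * thetaForm x i
    + 4 * s * torsionTwo κ q x y * phi κ a (q 0) (q 1) x y i

/-- The coefficient of `phi` in the `y`-derivative of the fibre metric. -/
def yRowZero (i : Fin 3) (x y : ℝ) : ℝ := 4 * s * torsionTwo κ q x y * thetaForm x i

/-- The `x`-derivative of the fibre metric. -/
def xDeriv (i j : Fin 3) (x y : ℝ) : ℝ :=
  xRowOne s κ a q X i x y * thetaForm y j + xRowTwo X i x y * thetaForm x j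
    + xRowZero s κ q i x y * phi κ a (q 0) (q 1) x y j

/-- The `y`-derivative of the fibre metric. -/
def yDeriv (i j : Fin 3) (x y : ℝ) : ℝ :=
  yRowOne X i x y * thetaForm y j + yRowTwo s κ a q X i x y * thetaForm x j
    + yRowZero s κ q i x y * phi κ a (q 0) (q 1) x y j

variable {X} {x y : ℝ}

theorem hasDerivAt_fibreMetric_x (hxy : x - y ≠ 0) (hX : DifferentiableAt ℝ (X 0) x)
    (i j : Fin 3) :
    HasDerivAt (fun t => fibreMetric s κ a (q 0) (q 1) (X 0) (X 1) i j t y)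
      (xDeriv s κ a q X i j x y) x := by
  have hu := (hasDerivAt_id' x).sub_const y
  have hp := hasDerivAt_phi_x (κ := κ) (a := a) (q := q 0) (r := q 1) hxy
  have ht := hasDerivAt_thetaForm_x hxy
  have h := (((hX.hasDerivAt.div hu hxy).mul_const (thetaForm y i * thetaForm y j)).add
    ((((hasDerivAt_const x (-X 1 y)).div hu hxy)).mul ((ht i).mul (ht j)))).add
    (((hp i).mul (hp j)).const_mul (4 * s))
  refine h.congr_deriv ?_
  simp only [xDeriv, xRowOne, xRowTwo, xRowZero, torsionOne, Pi.mul_apply, Pi.div_apply]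
  field_simp
  ring

theorem hasDerivAt_fibreMetric_y (hxy : x - y ≠ 0) (hX : DifferentiableAt ℝ (X 1) y)
    (i j : Fin 3) :
    HasDerivAt (fun t => fibreMetric s κ a (q 0) (q 1) (X 0) (X 1) i j x t)
      (yDeriv s κ a q X i j x y) y := by
  have hu := (hasDerivAt_id' y).const_sub x
  have hp := hasDerivAt_phi_y (κ := κ) (a := a) (q := q 0) (r := q 1) hxy
  have ht := hasDerivAt_thetaForm_y hxy
  have h := ((((hasDerivAt_const y (X 0 x)).div hu hxy).mul ((ht i).mul (ht j))).add
    ((hX.hasDerivAt.neg.div hu hxy).mul_const (thetaForm x i * thetaForm x j))).add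
    (((hp i).mul (hp j)).const_mul (4 * s))
  refine h.congr_deriv ?_
  simp only [yDeriv, yRowOne, yRowTwo, yRowZero, torsionTwo, Pi.mul_apply, Pi.div_apply,
    Pi.neg_apply]
  field_simp
  ring

end Derivatives

/-! ### Christoffel symbols. -/

section Christoffel

variable {X : Fin 2 → ℝ → ℝ} (N : Fin 2 → ℝ → ℝ) {p : Coord 2 → ℝ} {s κ a : ℝ} {q : Fin 2 → ℝ}

theorem pd_inr_metric (k : Fin 3) (i j : Coord 2) :
    pd (Sum.inr k : Coord 2) (fun x => metricWithSign s X N x i j) p = 0 := by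
  have h (t : ℝ) : xs (Function.update p (Sum.inr k) t) = xs p := by
    funext μ; simp [xs]
  simp [pd, metricWithSign, baseForm, fiberForm, potential, h]

theorem pd_metric_inl_inr (k : Coord 2) (μ : Fin 2) (j : Fin 3) :
    pd k (fun x => metricWithSign s X N x (Sum.inl μ) (Sum.inr j)) p = 0 := by
  simp only [metric_inl_inr, pd_const]

theorem pd_metric_inr_inl (k : Coord 2) (μ : Fin 2) (j : Fin 3) :
    pd k (fun x => metricWithSign s X N x (Sum.inr j) (Sum.inl μ)) p = 0 := by
  simp only [metric_inr_inl, pd_const]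

theorem pd_zero_metric_inr_inr (hp : p ∈ domain X)
    (hX : DifferentiableAt ℝ (X 0) (p (Sum.inl 0))) (i j : Fin 3) :
    pd (Sum.inl 0) (fun x => metricWithSign s X (fun μ => quad κ a (q μ)) x (Sum.inr i)
      (Sum.inr j)) p = xDeriv s κ a q X i j (p (Sum.inl 0)) (p (Sum.inl 1)) := by
  simp only [metric_inr_inr]
  exact pd_inl_zero (F := fibreMetric s κ a (q 0) (q 1) (X 0) (X 1) i j)
    (hasDerivAt_fibreMetric_x s κ a q (sub_ne_zero_of_mem_domain hp) hX i j)

theorem pd_one_metric_inr_inr (hp : p ∈ domain X)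
    (hX : DifferentiableAt ℝ (X 1) (p (Sum.inl 1))) (i j : Fin 3) :
    pd (Sum.inl 1) (fun x => metricWithSign s X (fun μ => quad κ a (q μ)) x (Sum.inr i)
      (Sum.inr j)) p = yDeriv s κ a q X i j (p (Sum.inl 0)) (p (Sum.inl 1)) := by
  simp only [metric_inr_inr]
  exact pd_inl_one (F := fibreMetric s κ a (q 0) (q 1) (X 0) (X 1) i j)
    (hasDerivAt_fibreMetric_y s κ a q (sub_ne_zero_of_mem_domain hp) hX i j)

theorem pd_metric_inl_inl_of_ne (k : Coord 2) {μ ν : Fin 2} (h : μ ≠ ν) :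
    pd k (fun x => metricWithSign s X N x (Sum.inl μ) (Sum.inl ν)) p = 0 := by
  simp only [metric_inl_inl, if_neg h, pd_const]

theorem pd_zero_metric_zero_zero (hp : p ∈ domain X)
    (hX : DifferentiableAt ℝ (X 0) (p (Sum.inl 0))) :
    pd (Sum.inl 0) (fun x => metricWithSign s X N x (Sum.inl 0) (Sum.inl 0)) p =
      1 / X 0 (p (Sum.inl 0)) - (p (Sum.inl 0) - p (Sum.inl 1)) * deriv (X 0) (p (Sum.inl 0))
        / X 0 (p (Sum.inl 0)) ^ 2 := by
  simp only [metric_inl_inl, if_true, Q_zero, one_div_div]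
  have h0 := zero_ne_of_mem_domain hp
  refine pd_inl_zero (F := fun x y => (x - y) / X 0 x) ?_
  refine (((hasDerivAt_id' _).sub_const _).div hX.hasDerivAt h0).congr_deriv ?_
  field_simp

theorem pd_one_metric_zero_zero :
    pd (Sum.inl 1) (fun x => metricWithSign s X N x (Sum.inl 0) (Sum.inl 0)) p =
      -1 / X 0 (p (Sum.inl 0)) := by
  simp only [metric_inl_inl, if_true, Q_zero, one_div_div]
  refine pd_inl_one (F := fun x y => (x - y) / X 0 x) ?_
  exact ((hasDerivAt_id' _).const_sub _).div_const _

theorem pd_zero_metric_one_one :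
    pd (Sum.inl 0) (fun x => metricWithSign s X N x (Sum.inl 1) (Sum.inl 1)) p =
      -1 / X 1 (p (Sum.inl 1)) := by
  simp only [metric_inl_inl, if_true, Q_one, one_div_div]
  refine pd_inl_zero (F := fun x y => (x - y) / -X 1 y) ?_
  refine (((hasDerivAt_id' _).sub_const _).div_const _).congr_deriv ?_
  rw [div_neg, neg_div]

theorem pd_one_metric_one_one (hp : p ∈ domain X)
    (hX : DifferentiableAt ℝ (X 1) (p (Sum.inl 1))) :
    pd (Sum.inl 1) (fun x => metricWithSign s X N x (Sum.inl 1) (Sum.inl 1)) p =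
      1 / X 1 (p (Sum.inl 1)) + (p (Sum.inl 0) - p (Sum.inl 1)) * deriv (X 1) (p (Sum.inl 1))
        / X 1 (p (Sum.inl 1)) ^ 2 := by
  simp only [metric_inl_inl, if_true, Q_one, one_div_div]
  have h1 := one_ne_of_mem_domain hp
  refine pd_inl_one (F := fun x y => (x - y) / -X 1 y) ?_
  refine (((hasDerivAt_id' _).const_sub _).div hX.hasDerivAt.neg
    (neg_ne_zero.2 h1)).congr_deriv ?_
  simp only [Pi.neg_apply]
  field_simp
  ring

/-- The Christoffel symbols with all indices along the `x` directions. -/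
def baseChristoffel (X : Fin 2 → ℝ → ℝ) (l m n : Fin 2) (x y : ℝ) : ℝ :=
  ![![![(1 / (x - y) - deriv (X 0) x / X 0 x) / 2, -1 / (2 * (x - y))],
      ![-1 / (2 * (x - y)), X 0 x / (2 * (x - y) * X 1 y)]],
    ![![-X 1 y / (2 * (x - y) * X 0 x), 1 / (2 * (x - y))],
      ![1 / (2 * (x - y)), (-1 / (x - y) - deriv (X 1) y / X 1 y) / 2]]] l m n

/-- The Christoffel symbols with a `ψ` index up and an `x` and a `ψ` index down. -/
def mixedChristoffel (s κ a : ℝ) (q : Fin 2 → ℝ) (X : Fin 2 → ℝ → ℝ) (m : Fin 2) (c j : Fin 3)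
    (x y : ℝ) : ℝ :=
  (1 / 2) * ((x - y) / X 0 x * ![xRowOne s κ a q X j x y, yRowOne X j x y] m
      * dualOne κ a (q 0) x y c
    + -(x - y) / X 1 y * ![xRowTwo X j x y, yRowTwo s κ a q X j x y] m
      * dualTwo κ a (q 1) x y c
    + s / 4 * ![xRowZero s κ q j x y, yRowZero s κ q j x y] m * dualZero c)

/-- The Christoffel symbols with an `x` index up and two `ψ` indices down. -/
def fibreChristoffel (s κ a : ℝ) (q : Fin 2 → ℝ) (X : Fin 2 → ℝ → ℝ) (m : Fin 2) (i j : Fin 3)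
    (x y : ℝ) : ℝ :=
  ![-(1 / 2) * (X 0 x / (x - y) * xDeriv s κ a q X i j x y),
    (1 / 2) * (X 1 y / (x - y) * yDeriv s κ a q X i j x y)] m

variable (κ a q) (hs : s * s = 1) (hp : p ∈ domain X)
  (hX : ∀ μ, DifferentiableAt ℝ (X μ) (p (Sum.inl μ)))
include hs hp

/-- A symbol with an odd number of `ψ` indices vanishes, because the metric is independent of `ψ`
and does not mix the two blocks. The next three lemmas are the other cases. -/
theorem christoffel_inr_inr_inr (c i j : Fin 3) :
    christoffel (metricWithSign s X fun μ => quad κ a (q μ)) (Sum.inr c) (Sum.inr i) (Sum.inr j) p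
      = 0 := by
  simp [christoffel, metric_inv κ a q hs hp, pd_inr_metric, inverseMetric_inr_inl]

theorem christoffel_inl_inl_inr (l m : Fin 2) (j : Fin 3) :
    christoffel (metricWithSign s X fun μ => quad κ a (q μ)) (Sum.inl l) (Sum.inl m) (Sum.inr j) p
      = 0 := by
  simp [christoffel, metric_inv κ a q hs hp, pd_inr_metric, inverseMetric_inl_inr,
    pd_metric_inl_inr, pd_metric_inr_inl]

theorem christoffel_inl_inr_inl (l m : Fin 2) (j : Fin 3) :
    christoffel (metricWithSign s X fun μ => quad κ a (q μ)) (Sum.inl l) (Sum.inr j) (Sum.inl m) p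
      = 0 := by
  simp [christoffel, metric_inv κ a q hs hp, pd_inr_metric, inverseMetric_inl_inr,
    pd_metric_inr_inl]

theorem christoffel_inr_inl_inl (l m : Fin 2) (j : Fin 3) :
    christoffel (metricWithSign s X fun μ => quad κ a (q μ)) (Sum.inr j) (Sum.inl l) (Sum.inl m) p
      = 0 := by
  simp [christoffel, metric_inv κ a q hs hp, pd_inr_metric, inverseMetric_inr_inl,
    pd_metric_inl_inr]

include hX

theorem christoffel_inl_inr_inr (m : Fin 2) (i j : Fin 3) :
    christoffel (metricWithSign s X fun μ => quad κ a (q μ)) (Sum.inl m) (Sum.inr i) (Sum.inr j) p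
      = fibreChristoffel s κ a q X m i j (p (Sum.inl 0)) (p (Sum.inl 1)) := by
  fin_cases m
  · simp [christoffel, metric_inv κ a q hs hp, pd_inr_metric, inverseMetric_inl_inr,
      inverseMetric_inl_inl, pd_zero_metric_inr_inr hp (hX 0), Q_zero,
      fibreChristoffel]
  · simp [christoffel, metric_inv κ a q hs hp, pd_inr_metric, inverseMetric_inl_inr,
      inverseMetric_inl_inl, pd_one_metric_inr_inr hp (hX 1), Q_one,
      fibreChristoffel]
    ring

theorem christoffel_inl_inl_inl (l m n : Fin 2) :
    christoffel (metricWithSign s X fun μ => quad κ a (q μ)) (Sum.inl l) (Sum.inl m) (Sum.inl n) p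
      = baseChristoffel X l m n (p (Sum.inl 0)) (p (Sum.inl 1)) := by
  have hu := sub_ne_zero_of_mem_domain hp
  have h0 := zero_ne_of_mem_domain hp
  have h1 := one_ne_of_mem_domain hp
  fin_cases l <;> fin_cases m <;> fin_cases n <;>
  · simp [christoffel, metric_inv κ a q hs hp, inverseMetric_inl_inr, inverseMetric_inl_inl,
      pd_zero_metric_zero_zero _ hp (hX 0), pd_one_metric_zero_zero, pd_zero_metric_one_one,
      pd_one_metric_one_one _ hp (hX 1), Q_one, Q_zero, baseChristoffel, pd_metric_inl_inl_of_ne]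
    field_simp
    try ring

/-- These symbols are half of `g⁻¹ ∂_m g` for the fibre metric. The derivative is expanded in the
frame and the inverse in the dual frame, so `sum_frame_mul_dual` contracts them term by term. -/
theorem christoffel_inr_inl_inr (m : Fin 2) (c j : Fin 3) :
    christoffel (metricWithSign s X fun μ => quad κ a (q μ)) (Sum.inr c) (Sum.inl m) (Sum.inr j) p
      = mixedChristoffel s κ a q X m c j (p (Sum.inl 0)) (p (Sum.inl 1)) := by
  have hu := sub_ne_zero_of_mem_domain hp
  have key (A B C : ℝ) := sum_frame_mul_dual (κ := κ) (a := a) (q := q 0) (r := q 1) hu A B C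
      ((p (Sum.inl 0) - p (Sum.inl 1)) / X 0 (p (Sum.inl 0))
        * dualOne κ a (q 0) (p (Sum.inl 0)) (p (Sum.inl 1)) c)
      (-(p (Sum.inl 0) - p (Sum.inl 1)) / X 1 (p (Sum.inl 1))
        * dualTwo κ a (q 1) (p (Sum.inl 0)) (p (Sum.inl 1)) c)
      (s / 4 * dualZero c)
  fin_cases m
  · simp only [Fin.zero_eta, christoffel, metric_inv κ a q hs hp, Fintype.sum_sum_type,
      inverseMetric_inr_inl, zero_mul, Finset.sum_const_zero, zero_add, pd_inr_metric,
      inverseMetric_inr_inr, pd_zero_metric_inr_inr hp (hX 0), pd_metric_inl_inr, add_zero,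
      sub_zero, mixedChristoffel, Matrix.cons_val_zero, mul_assoc]
    congr 1
    refine (Eq.trans ?_ (key (xRowOne s κ a q X j (p (Sum.inl 0)) (p (Sum.inl 1)))
      (xRowTwo X j (p (Sum.inl 0)) (p (Sum.inl 1)))
      (xRowZero s κ q j (p (Sum.inl 0)) (p (Sum.inl 1))))).trans ?_
    · refine Finset.sum_congr rfl fun l _ => ?_
      rw [xDeriv, fibreInverse]; ring
    · ring
  · simp only [Fin.mk_one, christoffel, metric_inv κ a q hs hp, Fintype.sum_sum_type,
      inverseMetric_inr_inl, zero_mul, Finset.sum_const_zero, zero_add, pd_inr_metric,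
      inverseMetric_inr_inr, pd_one_metric_inr_inr hp (hX 1), pd_metric_inl_inr, add_zero,
      sub_zero, mixedChristoffel, Matrix.cons_val_one, Matrix.cons_val_fin_one, mul_assoc]
    congr 1
    refine (Eq.trans ?_ (key (yRowOne X j (p (Sum.inl 0)) (p (Sum.inl 1)))
      (yRowTwo s κ a q X j (p (Sum.inl 0)) (p (Sum.inl 1)))
      (yRowZero s κ q j (p (Sum.inl 0)) (p (Sum.inl 1))))).trans ?_
    · refine Finset.sum_congr rfl fun l _ => ?_
      rw [yDeriv, fibreInverse]; ring
    · ring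

theorem christoffel_inr_inr_inl (m : Fin 2) (c j : Fin 3) :
    christoffel (metricWithSign s X fun μ => quad κ a (q μ)) (Sum.inr c) (Sum.inr j) (Sum.inl m) p
      = mixedChristoffel s κ a q X m c j (p (Sum.inl 0)) (p (Sum.inl 1)) := by
  rw [← christoffel_inr_inl_inr κ a q hs hp hX, christoffel, christoffel]
  simp only [Fintype.sum_sum_type, metric_inv κ a q hs hp, inverseMetric_inr_inl, pd_inr_metric,
    pd_metric_inl_inr, pd_metric_inr_inl, zero_mul, Finset.sum_const_zero, zero_add, add_zero]

end Christoffel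

/-- `D` is an open subset of the domain of the metric on which the functions `X μ` are `C²`. -/
structure RegularOn (X : Fin 2 → ℝ → ℝ) (D : Set (Coord 2 → ℝ)) : Prop where
  isOpen : IsOpen D
  subset : D ⊆ domain X
  contDiffAt : ∀ p ∈ D, ∀ μ, ContDiffAt ℝ 2 (X μ) (p (Sum.inl μ))

namespace RegularOn

variable {X : Fin 2 → ℝ → ℝ} {D : Set (Coord 2 → ℝ)} {p : Coord 2 → ℝ}

theorem differentiableAt (h : RegularOn X D) (hp : p ∈ D) (μ : Fin 2) :
    DifferentiableAt ℝ (X μ) (p (Sum.inl μ)) :=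
  (h.contDiffAt p hp μ).differentiableAt (by norm_num)

theorem differentiableAt_deriv (h : RegularOn X D) (hp : p ∈ D) (μ : Fin 2) :
    DifferentiableAt ℝ (deriv (X μ)) (p (Sum.inl μ)) := by
  have h1 : ContDiffAt ℝ 1 (deriv (X μ)) (p (Sum.inl μ)) :=
    (h.contDiffAt p hp μ).derivWithin (m := 1) (n := 2) (by norm_num)
  exact h1.differentiableAt (by norm_num)

end RegularOn

/-! ### Contractions of Christoffel symbols over the fibre. -/

section Contraction

variable {s κ a : ℝ} {q : Fin 2 → ℝ} {X : Fin 2 → ℝ → ℝ} {x y : ℝ}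

theorem sum_frame_mul_mixed (hxy : x - y ≠ 0) (m : Fin 2) (j : Fin 3) (A B C : ℝ) :
    ∑ c, (A * thetaForm y c + B * thetaForm x c + C * phi κ a (q 0) (q 1) x y c)
      * mixedChristoffel s κ a q X m c j x y
      = (1 / 2) * (A * ((x - y) / X 0 x * ![xRowOne s κ a q X j x y, yRowOne X j x y] m)
        + B * (-(x - y) / X 1 y * ![xRowTwo X j x y, yRowTwo s κ a q X j x y] m)
        + C * (s / 4 * ![xRowZero s κ q j x y, yRowZero s κ q j x y] m)) := by
  have key := sum_frame_mul_dual (κ := κ) (a := a) (q := q 0) (r := q 1) hxy A B C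
    ((x - y) / X 0 x * ![xRowOne s κ a q X j x y, yRowOne X j x y] m)
    (-(x - y) / X 1 y * ![xRowTwo X j x y, yRowTwo s κ a q X j x y] m)
    (s / 4 * ![xRowZero s κ q j x y, yRowZero s κ q j x y] m)
  rw [← key, Finset.mul_sum]
  refine Finset.sum_congr rfl fun c _ => ?_
  rw [mixedChristoffel]; ring

theorem sum_fibreChristoffel_mul_mixed_zero (hxy : x - y ≠ 0) (i j : Fin 3) :
    ∑ c, fibreChristoffel s κ a q X 0 i c x y * mixedChristoffel s κ a q X 0 c j x y
      = -(1 / 4) * (X 0 x / (x - y))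
        * ((x - y) / X 0 x * (xRowOne s κ a q X i x y * xRowOne s κ a q X j x y)
          + -(x - y) / X 1 y * (xRowTwo X i x y * xRowTwo X j x y)
          + s / 4 * (xRowZero s κ q i x y * xRowZero s κ q j x y)) := by
  have key := sum_frame_mul_mixed (s := s) (κ := κ) (a := a) (q := q) (X := X) hxy 0 j
    (-(1 / 2) * (X 0 x / (x - y)) * xRowOne s κ a q X i x y)
    (-(1 / 2) * (X 0 x / (x - y)) * xRowTwo X i x y)
    (-(1 / 2) * (X 0 x / (x - y)) * xRowZero s κ q i x y)
  refine (Eq.trans ?_ key).trans ?_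
  · refine Finset.sum_congr rfl fun c _ => ?_
    simp only [fibreChristoffel, xDeriv, Matrix.cons_val_zero]; ring
  · simp only [Matrix.cons_val_zero]; ring

theorem sum_fibreChristoffel_mul_mixed_one (hxy : x - y ≠ 0) (i j : Fin 3) :
    ∑ c, fibreChristoffel s κ a q X 1 i c x y * mixedChristoffel s κ a q X 1 c j x y
      = (1 / 4) * (X 1 y / (x - y))
        * ((x - y) / X 0 x * (yRowOne X i x y * yRowOne X j x y)
          + -(x - y) / X 1 y * (yRowTwo s κ a q X i x y * yRowTwo s κ a q X j x y)
          + s / 4 * (yRowZero s κ q i x y * yRowZero s κ q j x y)) := by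
  have key := sum_frame_mul_mixed (s := s) (κ := κ) (a := a) (q := q) (X := X) hxy 1 j
    ((1 / 2) * (X 1 y / (x - y)) * yRowOne X i x y)
    ((1 / 2) * (X 1 y / (x - y)) * yRowTwo s κ a q X i x y)
    ((1 / 2) * (X 1 y / (x - y)) * yRowZero s κ q i x y)
  refine (Eq.trans ?_ key).trans ?_
  · refine Finset.sum_congr rfl fun c _ => ?_
    simp only [fibreChristoffel, yDeriv, Matrix.cons_val_one, Matrix.cons_val_fin_one]; ring
  · simp only [Matrix.cons_val_one, Matrix.cons_val_fin_one]; ring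

/-- The frame `thetaForm y, thetaForm x, phi` as a matrix. -/
def frameMatrix (κ a : ℝ) (q : Fin 2 → ℝ) (x y : ℝ) : Matrix (Fin 3) (Fin 3) ℝ :=
  Matrix.of ![thetaForm y, thetaForm x, phi κ a (q 0) (q 1) x y]

/-- The dual frame as a matrix. -/
def dualMatrix (κ a : ℝ) (q : Fin 2 → ℝ) (x y : ℝ) : Matrix (Fin 3) (Fin 3) ℝ :=
  Matrix.of fun c A => ![dualOne κ a (q 0) x y c, dualTwo κ a (q 1) x y c, dualZero c] A

/-- The matrices `mixedChristoffel` in the frame. -/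
def connectionMatrix (s κ : ℝ) (q : Fin 2 → ℝ) (X : Fin 2 → ℝ → ℝ) (x y : ℝ) (m : Fin 2) :
    Matrix (Fin 3) (Fin 3) ℝ :=
  ![!![deriv (X 0) x / X 0 x - 1 / (x - y), X 1 y / ((x - y) * X 0 x),
        4 * s * torsionOne κ q x y * (x - y) / X 0 x;
      -1 / (x - y), 1 / (x - y), 0;
      torsionOne κ q x y, 0, 0],
    !![-1 / (x - y), 1 / (x - y), 0;
      -X 0 x / ((x - y) * X 1 y), deriv (X 1) y / X 1 y + 1 / (x - y),
        -4 * s * torsionTwo κ q x y * (x - y) / X 1 y;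
      0, torsionTwo κ q x y, 0]] m

theorem dualMatrix_mul_frameMatrix (hxy : x - y ≠ 0) :
    frameMatrix κ a q x y * dualMatrix κ a q x y = 1 := by
  rw [mul_eq_one_comm]
  ext i j
  rw [Matrix.one_apply]
  have := frame_complete (κ := κ) (a := a) (q := q 0) (r := q 1) hxy j i
  simp only [eq_comm (a := j)] at this
  rw [← this]
  simp [Matrix.mul_apply, Fin.sum_univ_three, frameMatrix, dualMatrix]
  ring

variable (s κ a q) (hxy : x - y ≠ 0) (hx : X 0 x ≠ 0) (hy : X 1 y ≠ 0) (hs : s * s = 1)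
include hxy hx hy hs

/-- A change of basis, after which traces may be taken of `connectionMatrix`, where neither `phi`
nor `a` occurs. -/
theorem mixedChristoffel_eq (m : Fin 2) (c j : Fin 3) : mixedChristoffel s κ a q X m c j x y
    = (1 / 2) * (dualMatrix κ a q x y * connectionMatrix s κ q X x y m
      * frameMatrix κ a q x y) c j := by
  rw [mixedChristoffel]
  congr 1
  fin_cases m
  · simp [Matrix.mul_apply, Fin.sum_univ_three, frameMatrix, dualMatrix, connectionMatrix,
      xRowOne, xRowTwo, xRowZero]
    field_simp
    linear_combination (x - y) ^ 2 * X 0 x * dualZero c * torsionOne κ q x y * thetaForm y j * hs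
  · simp [Matrix.mul_apply, Fin.sum_univ_three, frameMatrix, dualMatrix, connectionMatrix,
      yRowOne, yRowTwo, yRowZero]
    field_simp
    linear_combination (x - y) ^ 2 * X 1 y * dualZero c * torsionTwo κ q x y * thetaForm x j * hs

theorem sum_mixedChristoffel_mul (m n : Fin 2) :
    ∑ c, ∑ d, mixedChristoffel s κ a q X m c d x y * mixedChristoffel s κ a q X n d c x y
      = (1 / 4) * (connectionMatrix s κ q X x y m * connectionMatrix s κ q X x y n).trace := by
  set V := dualMatrix κ a q x y with hV
  set T := frameMatrix κ a q x y with hT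
  have hTV : T * V = 1 := dualMatrix_mul_frameMatrix hxy
  have h : (V * connectionMatrix s κ q X x y m * T * (V * connectionMatrix s κ q X x y n
      * T)).trace = (connectionMatrix s κ q X x y m * connectionMatrix s κ q X x y n).trace := by
    rw [show V * connectionMatrix s κ q X x y m * T * (V * connectionMatrix s κ q X x y n * T)
      = V * (connectionMatrix s κ q X x y m * (T * V) * connectionMatrix s κ q X x y n * T) by
        simp only [Matrix.mul_assoc], Matrix.trace_mul_comm, hTV, Matrix.mul_one,
      Matrix.mul_assoc, hTV, Matrix.mul_one]
  rw [← h, Matrix.trace, Finset.mul_sum]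
  refine Finset.sum_congr rfl fun c _ => ?_
  rw [Matrix.diag_apply, Matrix.mul_apply, Finset.mul_sum]
  refine Finset.sum_congr rfl fun d _ => ?_
  rw [mixedChristoffel_eq s κ a q hxy hx hy hs, mixedChristoffel_eq s κ a q hxy hx hy hs]
  ring

/-- This is half the logarithmic derivative of the determinant of the fibre metric. That determinant
is a constant times `X 0 x * X 1 y`: the factors `1 / (x - y)` of the two `Q_μ` cancel against the
squared determinant of the frame. -/
theorem sum_mixedChristoffel (m : Fin 2) :
    ∑ c, mixedChristoffel s κ a q X m c c x y
      = (1 / 2) * ![deriv (X 0) x / X 0 x, deriv (X 1) y / X 1 y] m := by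
  set V := dualMatrix κ a q x y with hV
  set T := frameMatrix κ a q x y with hT
  have hTV : T * V = 1 := dualMatrix_mul_frameMatrix hxy
  have h : (V * connectionMatrix s κ q X x y m * T).trace
      = ![deriv (X 0) x / X 0 x, deriv (X 1) y / X 1 y] m := by
    rw [Matrix.mul_assoc, Matrix.trace_mul_comm, Matrix.mul_assoc, hTV, Matrix.mul_one]
    fin_cases m
    · simp [connectionMatrix, Matrix.trace_fin_three]
    · simp [connectionMatrix, Matrix.trace_fin_three]; ring
  rw [← h, Matrix.trace, Finset.mul_sum]
  refine Finset.sum_congr rfl fun c _ => ?_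
  rw [mixedChristoffel_eq s κ a q hxy hx hy hs, Matrix.diag_apply]

end Contraction

/-! ### Second derivatives of the fibre metric. -/

section SecondDerivatives

variable (s κ a : ℝ) (q : Fin 2 → ℝ) {X : Fin 2 → ℝ → ℝ} {x y : ℝ}

theorem hasDerivAt_torsionOne (hxy : x - y ≠ 0) :
    HasDerivAt (fun t => torsionOne κ q t y) (2 * (q 0 - q 1) / (x - y) ^ 3) x := by
  have h := ((hasDerivAt_const x (q 0 - q 1)).div (((hasDerivAt_id' x).sub_const y).pow 2)
    (pow_ne_zero 2 hxy)).const_sub κ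
  refine h.congr_deriv ?_
  simp only [Pi.pow_apply]
  field_simp
  ring

theorem hasDerivAt_torsionTwo (hxy : x - y ≠ 0) :
    HasDerivAt (fun t => torsionTwo κ q x t) (2 * (q 0 - q 1) / (x - y) ^ 3) y := by
  have h := ((hasDerivAt_const y (q 0 - q 1)).div (((hasDerivAt_id' y).const_sub x).pow 2)
    (pow_ne_zero 2 hxy)).const_add κ
  refine h.congr_deriv ?_
  simp only [Pi.pow_apply]
  field_simp
  ring

theorem hasDerivAt_fibreChristoffel_zero (hxy : x - y ≠ 0) (hX : DifferentiableAt ℝ (X 0) x)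
    (hX' : DifferentiableAt ℝ (deriv (X 0)) x) (i j : Fin 3) :
    HasDerivAt (fun t => fibreChristoffel s κ a q X 0 i j t y)
      (-(1 / 2) * ((deriv (X 0) x / (x - y) - X 0 x / (x - y) ^ 2) * xDeriv s κ a q X i j x y
        + X 0 x / (x - y) * (
          (deriv (deriv (X 0)) x / (x - y) - 2 * deriv (X 0) x / (x - y) ^ 2
            + 2 * (X 0 x - X 1 y) / (x - y) ^ 3) * (thetaForm y i * thetaForm y j)
          + 4 * s * (2 * (q 0 - q 1) / (x - y) ^ 3
              * (thetaForm y i * phi κ a (q 0) (q 1) x y j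
                + phi κ a (q 0) (q 1) x y i * thetaForm y j)
            + 2 * torsionOne κ q x y ^ 2 * (thetaForm y i * thetaForm y j))))) x := by
  have hu := (hasDerivAt_id' x).sub_const y
  have hp := hasDerivAt_phi_x (κ := κ) (a := a) (q := q 0) (r := q 1) hxy
  have ht := hasDerivAt_thetaForm_x hxy
  have hα := hasDerivAt_torsionOne κ q hxy
  have h1 := (((hX'.hasDerivAt.div hu hxy).sub (hX.hasDerivAt.div (hu.pow 2)
    (pow_ne_zero 2 hxy))).mul_const (thetaForm y i * thetaForm y j))
  have hY := (hasDerivAt_const x (X 1 y)).div (hu.pow 2) (pow_ne_zero 2 hxy)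
  have h2 := hY.mul ((((ht i).mul_const (thetaForm y j)).add
    ((ht j).const_mul (thetaForm y i))).sub ((ht i).mul (ht j)))
  have h3 := (hα.mul (((hp j).const_mul (thetaForm y i)).add
    ((hp i).mul_const (thetaForm y j)))).const_mul (4 * s)
  have h := ((hX.hasDerivAt.div hu hxy).mul ((h1.add h2).add h3)).const_mul (-(1 / 2))
  refine (h.congr_deriv ?_).congr_of_eventuallyEq (Filter.Eventually.of_forall fun t => ?_)
  · simp only [xDeriv, xRowOne, xRowTwo, xRowZero, torsionOne, Pi.mul_apply, Pi.div_apply,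
      Pi.add_apply, Pi.sub_apply, Pi.pow_apply]
    field_simp
    ring
  · simp only [fibreChristoffel, xDeriv, xRowOne, xRowTwo, xRowZero, Pi.mul_apply, Pi.div_apply,
      Pi.add_apply, Pi.sub_apply, Pi.pow_apply, Matrix.cons_val_zero]
    ring

theorem hasDerivAt_fibreChristoffel_one (hxy : x - y ≠ 0) (hX : DifferentiableAt ℝ (X 1) y)
    (hX' : DifferentiableAt ℝ (deriv (X 1)) y) (i j : Fin 3) :
    HasDerivAt (fun t => fibreChristoffel s κ a q X 1 i j x t)
      ((1 / 2) * ((deriv (X 1) y / (x - y) + X 1 y / (x - y) ^ 2) * yDeriv s κ a q X i j x y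
        + X 1 y / (x - y) * (
          (-deriv (deriv (X 1)) y / (x - y) - 2 * deriv (X 1) y / (x - y) ^ 2
            + 2 * (X 0 x - X 1 y) / (x - y) ^ 3) * (thetaForm x i * thetaForm x j)
          + 4 * s * (2 * (q 0 - q 1) / (x - y) ^ 3
              * (thetaForm x i * phi κ a (q 0) (q 1) x y j
                + phi κ a (q 0) (q 1) x y i * thetaForm x j)
            + 2 * torsionTwo κ q x y ^ 2 * (thetaForm x i * thetaForm x j))))) y := by
  have hu := (hasDerivAt_id' y).const_sub x
  have hp := hasDerivAt_phi_y (κ := κ) (a := a) (q := q 0) (r := q 1) hxy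
  have ht := hasDerivAt_thetaForm_y hxy
  have hβ := hasDerivAt_torsionTwo κ q hxy
  have h1 := (((hX'.hasDerivAt.neg.div hu hxy).sub (hX.hasDerivAt.div (hu.pow 2)
    (pow_ne_zero 2 hxy))).mul_const (thetaForm x i * thetaForm x j))
  have hY := (hasDerivAt_const y (X 0 x)).div (hu.pow 2) (pow_ne_zero 2 hxy)
  have h2 := hY.mul ((((ht i).mul_const (thetaForm x j)).add
    ((ht j).const_mul (thetaForm x i))).sub ((ht i).mul (ht j)))
  have h3 := (hβ.mul (((hp j).const_mul (thetaForm x i)).add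
    ((hp i).mul_const (thetaForm x j)))).const_mul (4 * s)
  have h := ((hX.hasDerivAt.div hu hxy).mul ((h1.add h2).add h3)).const_mul (1 / 2)
  refine (h.congr_deriv ?_).congr_of_eventuallyEq (Filter.Eventually.of_forall fun t => ?_)
  · simp only [yDeriv, yRowOne, yRowTwo, yRowZero, torsionTwo, Pi.mul_apply, Pi.div_apply,
      Pi.add_apply, Pi.sub_apply, Pi.pow_apply, Pi.neg_apply]
    field_simp
    ring
  · simp only [fibreChristoffel, yDeriv, yRowOne, yRowTwo, yRowZero, Pi.mul_apply, Pi.div_apply,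
      Pi.add_apply, Pi.sub_apply, Pi.pow_apply, Pi.neg_apply, Matrix.cons_val_one,
      Matrix.cons_val_fin_one]
    ring

end SecondDerivatives

/-! ### The Ricci tensor: mixed and fibre components. -/

section RicciFibre

variable {X : Fin 2 → ℝ → ℝ} {D : Set (Coord 2 → ℝ)} {p : Coord 2 → ℝ} {s κ a : ℝ}
  {q : Fin 2 → ℝ}

/-- The Ricci curvature in the directions `e¹` and `ê¹`. -/
def ricciOne (s κ : ℝ) (q : Fin 2 → ℝ) (X : Fin 2 → ℝ → ℝ) (x y : ℝ) : ℝ :=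
  -deriv (deriv (X 0)) x / (2 * (x - y)) + (deriv (X 0) x - deriv (X 1) y) / (2 * (x - y) ^ 2)
    - 2 * s * torsionOne κ q x y ^ 2

/-- The Ricci curvature in the directions `e²` and `ê²`. -/
def ricciTwo (s κ : ℝ) (q : Fin 2 → ℝ) (X : Fin 2 → ℝ → ℝ) (x y : ℝ) : ℝ :=
  deriv (deriv (X 1)) y / (2 * (x - y)) - (deriv (X 0) x - deriv (X 1) y) / (2 * (x - y) ^ 2)
    - 2 * s * torsionTwo κ q x y ^ 2

/-- The Ricci curvature in the direction `e⁰`. -/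
def ricciZero (κ : ℝ) (q : Fin 2 → ℝ) (x y : ℝ) : ℝ :=
  2 * (torsionOne κ q x y ^ 2 + torsionTwo κ q x y ^ 2)

theorem pd_inr_eq_zero (hD : RegularOn X D) (hp : p ∈ D) (k : Fin 3) {f : (Coord 2 → ℝ) → ℝ}
    {F : ℝ → ℝ → ℝ} (h : ∀ q ∈ D, f q = F (q (Sum.inl 0)) (q (Sum.inl 1))) :
    pd (Sum.inr k : Coord 2) f p = 0 := by
  rw [pd_congr hD.isOpen hp h, pd_inr]

theorem pd_eq_zero (hD : RegularOn X D) (hp : p ∈ D) (k : Coord 2) {f : (Coord 2 → ℝ) → ℝ}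
    (h : ∀ q ∈ D, f q = 0) : pd k f p = 0 := by
  rw [pd_congr hD.isOpen hp h, pd_const]

variable (κ a q) (hs : s * s = 1) (hD : RegularOn X D) (hp : p ∈ D)
include hs hD hp

theorem pd_christoffel_inr_inr_inr (k : Coord 2) (c i j : Fin 3) :
    pd k (christoffel (metricWithSign s X fun μ => quad κ a (q μ))
      (Sum.inr c) (Sum.inr i) (Sum.inr j)) p = 0 :=
  pd_eq_zero hD hp k fun _ h => christoffel_inr_inr_inr κ a q hs (hD.subset h) c i j

theorem pd_christoffel_inl_inl_inr (k : Coord 2) (l m : Fin 2) (j : Fin 3) :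
    pd k (christoffel (metricWithSign s X fun μ => quad κ a (q μ))
      (Sum.inl l) (Sum.inl m) (Sum.inr j)) p = 0 :=
  pd_eq_zero hD hp k fun _ h => christoffel_inl_inl_inr κ a q hs (hD.subset h) l m j

theorem pd_christoffel_inl_inr_inl (k : Coord 2) (l m : Fin 2) (j : Fin 3) :
    pd k (christoffel (metricWithSign s X fun μ => quad κ a (q μ))
      (Sum.inl l) (Sum.inr j) (Sum.inl m)) p = 0 :=
  pd_eq_zero hD hp k fun _ h => christoffel_inl_inr_inl κ a q hs (hD.subset h) l m j

theorem pd_christoffel_inr_inl_inl (k : Coord 2) (l m : Fin 2) (j : Fin 3) :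
    pd k (christoffel (metricWithSign s X fun μ => quad κ a (q μ))
      (Sum.inr j) (Sum.inl l) (Sum.inl m)) p = 0 :=
  pd_eq_zero hD hp k fun _ h => christoffel_inr_inl_inl κ a q hs (hD.subset h) l m j

theorem pd_inr_christoffel_inr_inl_inr (k : Fin 3) (m : Fin 2) (c j : Fin 3) :
    pd (Sum.inr k : Coord 2) (christoffel (metricWithSign s X fun μ => quad κ a (q μ))
      (Sum.inr c) (Sum.inl m) (Sum.inr j)) p = 0 :=
  pd_inr_eq_zero hD hp k fun _ h =>
    christoffel_inr_inl_inr κ a q hs (hD.subset h) (hD.differentiableAt h) m c j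

theorem pd_inr_christoffel_inr_inr_inl (k : Fin 3) (m : Fin 2) (c j : Fin 3) :
    pd (Sum.inr k : Coord 2) (christoffel (metricWithSign s X fun μ => quad κ a (q μ))
      (Sum.inr c) (Sum.inr j) (Sum.inl m)) p = 0 :=
  pd_inr_eq_zero hD hp k fun _ h =>
    christoffel_inr_inr_inl κ a q hs (hD.subset h) (hD.differentiableAt h) m c j

theorem pd_inr_christoffel_inl_inl_inl (k : Fin 3) (l m n : Fin 2) :
    pd (Sum.inr k : Coord 2) (christoffel (metricWithSign s X fun μ => quad κ a (q μ))
      (Sum.inl l) (Sum.inl m) (Sum.inl n)) p = 0 :=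
  pd_inr_eq_zero hD hp k fun _ h =>
    christoffel_inl_inl_inl κ a q hs (hD.subset h) (hD.differentiableAt h) l m n

theorem pd_christoffel_inl_inr_inr (m : Fin 2) (i j : Fin 3) :
    pd (Sum.inl m) (christoffel (metricWithSign s X fun μ => quad κ a (q μ))
      (Sum.inl m) (Sum.inr i) (Sum.inr j)) p
      = pd (Sum.inl m) (fun p : Coord 2 → ℝ =>
        fibreChristoffel s κ a q X m i j (p (Sum.inl 0)) (p (Sum.inl 1))) p :=
  pd_congr hD.isOpen hp (fun _ h =>
    christoffel_inl_inr_inr κ a q hs (hD.subset h) (hD.differentiableAt h) m i j) _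

theorem ricci_inl_inr (m : Fin 2) (j : Fin 3) :
    ricci (metricWithSign s X fun μ => quad κ a (q μ)) (Sum.inl m) (Sum.inr j) p = 0 := by
  have hp' := hD.subset hp
  simp [ricci, pd_christoffel_inl_inl_inr κ a q hs hD hp,
    pd_inr_christoffel_inr_inl_inr κ a q hs hD hp, pd_inr_christoffel_inl_inl_inl κ a q hs hD hp,
    christoffel_inr_inr_inr κ a q hs hp', christoffel_inl_inl_inr κ a q hs hp',
    christoffel_inl_inr_inl κ a q hs hp', christoffel_inr_inl_inl κ a q hs hp']

theorem ricci_inr_inl (m : Fin 2) (j : Fin 3) :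
    ricci (metricWithSign s X fun μ => quad κ a (q μ)) (Sum.inr j) (Sum.inl m) p = 0 := by
  have hp' := hD.subset hp
  simp [ricci, pd_christoffel_inr_inr_inr κ a q hs hD hp,
    pd_christoffel_inl_inr_inl κ a q hs hD hp,
    pd_inr_christoffel_inr_inr_inl κ a q hs hD hp,
    christoffel_inr_inr_inr κ a q hs hp', christoffel_inl_inl_inr κ a q hs hp',
    christoffel_inl_inr_inl κ a q hs hp', christoffel_inr_inl_inl κ a q hs hp']

/-- What remains of the Ricci tensor is the divergence of `fibreChristoffel`, its product with the
traced symbols, and the fibre contractions already evaluated. Each is a quadratic form in the frame,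
and the off-diagonal coefficients cancel. -/
theorem ricci_inr_inr (i j : Fin 3) :
    ricci (metricWithSign s X fun μ => quad κ a (q μ)) (Sum.inr i) (Sum.inr j) p =
      ricciOne s κ q X (p (Sum.inl 0)) (p (Sum.inl 1)) *
        (X 0 (p (Sum.inl 0)) / (p (Sum.inl 0) - p (Sum.inl 1))
          * (thetaForm (p (Sum.inl 1)) i * thetaForm (p (Sum.inl 1)) j))
      + ricciTwo s κ q X (p (Sum.inl 0)) (p (Sum.inl 1)) *
        (-X 1 (p (Sum.inl 1)) / (p (Sum.inl 0) - p (Sum.inl 1))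
          * (thetaForm (p (Sum.inl 0)) i * thetaForm (p (Sum.inl 0)) j))
      + ricciZero κ q (p (Sum.inl 0)) (p (Sum.inl 1)) *
        (4 * (phi κ a (q 0) (q 1) (p (Sum.inl 0)) (p (Sum.inl 1)) i
          * phi κ a (q 0) (q 1) (p (Sum.inl 0)) (p (Sum.inl 1)) j)) := by
  have hp' := hD.subset hp
  have hd := hD.differentiableAt hp
  have hu := sub_ne_zero_of_mem_domain hp'
  have h0 := zero_ne_of_mem_domain hp'
  have h1 := one_ne_of_mem_domain hp'
  have e0 := sum_fibreChristoffel_mul_mixed_zero (s := s) (κ := κ) (a := a) (q := q) (X := X) hu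
  have e1 := sum_fibreChristoffel_mul_mixed_one (s := s) (κ := κ) (a := a) (q := q) (X := X) hu
  have t := sum_mixedChristoffel s κ a q hu h0 h1 hs
  have d0 := pd_inl_zero (F := fibreChristoffel s κ a q X 0 i j)
    (hasDerivAt_fibreChristoffel_zero s κ a q hu (hd 0) (hD.differentiableAt_deriv hp 0) i j)
  have d1 := pd_inl_one (F := fibreChristoffel s κ a q X 1 i j)
    (hasDerivAt_fibreChristoffel_one s κ a q hu (hd 1) (hD.differentiableAt_deriv hp 1) i j)
  -- The quadratic terms of the Ricci tensor contain this contraction with the factors in either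
  -- order.
  have e0' := (Finset.sum_congr rfl fun c _ => mul_comm _ _).trans (e0 i j)
  have e1' := (Finset.sum_congr rfl fun c _ => mul_comm _ _).trans (e1 i j)
  simp only [ricci, Fintype.sum_sum_type, Fin.sum_univ_two,
    pd_christoffel_inr_inr_inr κ a q hs hD hp, pd_christoffel_inl_inr_inr κ a q hs hD hp,
    pd_christoffel_inl_inr_inl κ a q hs hD hp,
    christoffel_inr_inr_inr κ a q hs hp',
    christoffel_inl_inr_inl κ a q hs hp', christoffel_inl_inr_inr κ a q hs hp' hd,
    christoffel_inr_inr_inl κ a q hs hp' hd,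
    christoffel_inl_inl_inl κ a q hs hp' hd, mul_zero, sub_zero, zero_add,
    add_zero, Finset.sum_const_zero, Finset.sum_sub_distrib, Finset.sum_add_distrib,
    ← Finset.sum_mul, d0, d1, e0, e1, t, e0', e1']
  generalize p (Sum.inl 0) = x at *
  generalize p (Sum.inl 1) = y at *
  clear e0 e1 t d0 d1 hp' hd hp
  simp only [fibreChristoffel, baseChristoffel, xDeriv, yDeriv, xRowOne, xRowTwo, xRowZero, yRowOne,
    yRowTwo, yRowZero, ricciOne, ricciTwo, ricciZero, Matrix.cons_val]
  -- All derivatives have been taken, so the components of `phi` are from here on independent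
  -- variables; `N` enters otherwise only through the torsion coefficients.
  generalize phi κ a (q 0) (q 1) x y i = φi
  generalize phi κ a (q 0) (q 1) x y j = φj
  simp only [torsionOne, torsionTwo]
  rcases mul_self_eq_one_iff.1 hs with rfl | rfl
  · field_simp
    ring
  · field_simp
    ring

end RicciFibre

/-! ### Differentiability of the mixed Christoffel symbols. -/

section Differentiability

variable (s κ a : ℝ) (q : Fin 2 → ℝ) {X : Fin 2 → ℝ → ℝ} {x y : ℝ}

/-- Needed, like its companion in `y`, only to move a partial derivative out of the sum that forms
the trace of these symbols; the individual derivatives are never computed. -/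
theorem differentiableAt_mixedChristoffel_x (hxy : x - y ≠ 0) (hx : X 0 x ≠ 0)
    (hX : DifferentiableAt ℝ (X 0) x) (hX' : DifferentiableAt ℝ (deriv (X 0)) x)
    (m : Fin 2) (c j : Fin 3) :
    DifferentiableAt ℝ (fun t => mixedChristoffel s κ a q X m c j t y) x := by
  have hp := fun i => (hasDerivAt_phi_x (κ := κ) (a := a) (q := q 0) (r := q 1) hxy
    i).differentiableAt
  have ht := fun i => (hasDerivAt_thetaForm_x hxy i).differentiableAt
  have hα := (hasDerivAt_torsionOne κ q hxy).differentiableAt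
  have hβ : DifferentiableAt ℝ (fun t => torsionTwo κ q t y) x := by
    unfold torsionTwo
    fun_prop (disch := positivity)
  have hN := (hasDerivAt_quad (κ := κ) (a := a) (q := q 0) x).differentiableAt
  have h1 (i : Fin 3) : DifferentiableAt ℝ (fun t => dualOne κ a (q 0) t y i) x := by
    fin_cases i <;> simp [dualOne] <;> fun_prop (disch := assumption)
  have h2 (i : Fin 3) : DifferentiableAt ℝ (fun t => dualTwo κ a (q 1) t y i) x := by
    fin_cases i <;> simp [dualTwo] <;> fun_prop (disch := assumption)
  have hu2 : (x - y) ^ 2 ≠ 0 := pow_ne_zero 2 hxy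
  simp only [mixedChristoffel]
  fin_cases m
  · simp [xRowOne, xRowTwo, xRowZero]
    fun_prop (disch := assumption)
  · simp [yRowOne, yRowTwo, yRowZero]
    fun_prop (disch := assumption)

theorem differentiableAt_mixedChristoffel_y (hxy : x - y ≠ 0) (hy : X 1 y ≠ 0)
    (hX : DifferentiableAt ℝ (X 1) y) (hX' : DifferentiableAt ℝ (deriv (X 1)) y)
    (m : Fin 2) (c j : Fin 3) :
    DifferentiableAt ℝ (fun t => mixedChristoffel s κ a q X m c j x t) y := by
  have hp := fun i => (hasDerivAt_phi_y (κ := κ) (a := a) (q := q 0) (r := q 1) hxy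
    i).differentiableAt
  have ht := fun i => (hasDerivAt_thetaForm_y hxy i).differentiableAt
  have hβ := (hasDerivAt_torsionTwo κ q hxy).differentiableAt
  have hα : DifferentiableAt ℝ (fun t => torsionOne κ q x t) y := by
    unfold torsionOne
    fun_prop (disch := positivity)
  have hN := (hasDerivAt_quad (κ := κ) (a := a) (q := q 1) y).differentiableAt
  have h1 (i : Fin 3) : DifferentiableAt ℝ (fun t => dualOne κ a (q 0) x t i) y := by
    fin_cases i <;> simp [dualOne] <;> fun_prop (disch := assumption)
  have h2 (i : Fin 3) : DifferentiableAt ℝ (fun t => dualTwo κ a (q 1) x t i) y := by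
    fin_cases i <;> simp [dualTwo] <;> fun_prop (disch := assumption)
  have hu2 : (x - y) ^ 2 ≠ 0 := pow_ne_zero 2 hxy
  simp only [mixedChristoffel]
  fin_cases m
  · simp [xRowOne, xRowTwo, xRowZero]
    fun_prop (disch := assumption)
  · simp [yRowOne, yRowTwo, yRowZero]
    fun_prop (disch := assumption)

end Differentiability

/-! ### The Ricci tensor: base components. -/

section RicciBase

variable {X : Fin 2 → ℝ → ℝ} {D : Set (Coord 2 → ℝ)} {p : Coord 2 → ℝ} {s : ℝ}
  (κ a : ℝ) (q : Fin 2 → ℝ) (hs : s * s = 1) (hD : RegularOn X D) (hp : p ∈ D)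
include hs hD hp

theorem pd_christoffel_inl_inl_inl (k : Coord 2) (l m n : Fin 2) :
    pd k (christoffel (metricWithSign s X fun μ => quad κ a (q μ))
      (Sum.inl l) (Sum.inl m) (Sum.inl n)) p
      = pd k (fun p : Coord 2 → ℝ =>
        baseChristoffel X l m n (p (Sum.inl 0)) (p (Sum.inl 1))) p :=
  pd_congr hD.isOpen hp (fun _ h =>
    christoffel_inl_inl_inl κ a q hs (hD.subset h) (hD.differentiableAt h) l m n) _

theorem pd_christoffel_inr_inl_inr (k : Coord 2) (m : Fin 2) (c j : Fin 3) :
    pd k (christoffel (metricWithSign s X fun μ => quad κ a (q μ))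
      (Sum.inr c) (Sum.inl m) (Sum.inr j)) p
      = pd k (fun p : Coord 2 → ℝ =>
        mixedChristoffel s κ a q X m c j (p (Sum.inl 0)) (p (Sum.inl 1))) p :=
  pd_congr hD.isOpen hp (fun _ h =>
    christoffel_inr_inl_inr κ a q hs (hD.subset h) (hD.differentiableAt h) m c j) _

theorem sum_pd_christoffel_inr_inl_inr (k m : Fin 2) :
    ∑ c, pd (Sum.inl k) (christoffel (metricWithSign s X fun μ => quad κ a (q μ))
      (Sum.inr c) (Sum.inl m) (Sum.inr c)) p
      = pd (Sum.inl k) (fun p : Coord 2 → ℝ => (1 / 2)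
        * ![deriv (X 0) (p (Sum.inl 0)) / X 0 (p (Sum.inl 0)),
          deriv (X 1) (p (Sum.inl 1)) / X 1 (p (Sum.inl 1))] m) p := by
  simp only [pd_christoffel_inr_inl_inr κ a q hs hD hp]
  rw [← pd_congr hD.isOpen hp fun q' h => sum_mixedChristoffel s κ a q
    (sub_ne_zero_of_mem_domain (hD.subset h)) (zero_ne_of_mem_domain (hD.subset h))
    (one_ne_of_mem_domain (hD.subset h)) hs m]
  have hp' := hD.subset hp
  have hu := sub_ne_zero_of_mem_domain hp'
  unfold pd
  rw [deriv_fun_sum]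
  intro c _
  fin_cases k
  · simpa using differentiableAt_mixedChristoffel_x s κ a q hu (zero_ne_of_mem_domain hp')
      (hD.differentiableAt hp 0) (hD.differentiableAt_deriv hp 0) m c c
  · simpa using differentiableAt_mixedChristoffel_y s κ a q hu (one_ne_of_mem_domain hp')
      (hD.differentiableAt hp 1) (hD.differentiableAt_deriv hp 1) m c c

/-- The fibre enters only through `sum_mixedChristoffel` and `sum_mixedChristoffel_mul`, that is,
through the derivatives of `log |X 0 x * X 1 y|` and the traces of products of connection matrices.
The rest is the curvature of the two-dimensional base. -/
theorem ricci_inl_inl (m n : Fin 2) :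
    ricci (metricWithSign s X fun μ => quad κ a (q μ)) (Sum.inl m) (Sum.inl n) p =
      !![ricciOne s κ q X (p (Sum.inl 0)) (p (Sum.inl 1))
          * ((p (Sum.inl 0) - p (Sum.inl 1)) / X 0 (p (Sum.inl 0))), 0;
        0, ricciTwo s κ q X (p (Sum.inl 0)) (p (Sum.inl 1))
          * (-(p (Sum.inl 0) - p (Sum.inl 1)) / X 1 (p (Sum.inl 1)))] m n := by
  have hp' := hD.subset hp
  have hd := hD.differentiableAt hp
  have hd' := hD.differentiableAt_deriv hp
  have hu := sub_ne_zero_of_mem_domain hp'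
  have h0 := zero_ne_of_mem_domain hp'
  have h1 := one_ne_of_mem_domain hp'
  have t := sum_mixedChristoffel s κ a q hu h0 h1 hs
  have tt := sum_mixedChristoffel_mul s κ a q hu h0 h1 hs
  simp only [ricci, Fintype.sum_sum_type, Fin.sum_univ_two, Finset.sum_sub_distrib,
    Finset.sum_add_distrib, sum_pd_christoffel_inr_inl_inr κ a q hs hD hp,
    pd_christoffel_inr_inl_inl κ a q hs hD hp, pd_christoffel_inl_inl_inl κ a q hs hD hp,
    christoffel_inl_inl_inr κ a q hs hp', christoffel_inr_inl_inl κ a q hs hp',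
    christoffel_inr_inl_inr κ a q hs hp' hd, christoffel_inr_inr_inl κ a q hs hp' hd,
    christoffel_inl_inl_inl κ a q hs hp' hd, mul_zero, zero_add,
    add_zero, Finset.sum_const_zero, ← Finset.sum_mul, t, tt]
  have hux := (hasDerivAt_id' (p (Sum.inl 0))).sub_const (p (Sum.inl 1))
  have huy := (hasDerivAt_id' (p (Sum.inl 1))).const_sub (p (Sum.inl 0))
  have h2u : 2 * (p (Sum.inl 0) - p (Sum.inl 1)) ≠ 0 := mul_ne_zero two_ne_zero hu
  have mx := pd_inl_zero (p := p) (F := fun x y => -1 / (2 * (x - y)))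
    ((hasDerivAt_const _ (-1)).div (hux.const_mul 2) h2u)
  have my := pd_inl_one (p := p) (F := fun x y => -1 / (2 * (x - y)))
    ((hasDerivAt_const _ (-1)).div (huy.const_mul 2) h2u)
  have px := pd_inl_zero (p := p) (F := fun x y => 1 / (2 * (x - y)))
    ((hasDerivAt_const _ 1).div (hux.const_mul 2) h2u)
  have py := pd_inl_one (p := p) (F := fun x y => 1 / (2 * (x - y)))
    ((hasDerivAt_const _ 1).div (huy.const_mul 2) h2u)
  have tx := pd_inl_zero (p := p) (F := fun x _ => 1 / 2 * (deriv (X 0) x / X 0 x))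
    (((hd' 0).hasDerivAt.div (hd 0).hasDerivAt h0).const_mul (1 / 2))
  have ty := pd_inl_one (p := p) (F := fun _ y => 1 / 2 * (deriv (X 1) y / X 1 y))
    (((hd' 1).hasDerivAt.div (hd 1).hasDerivAt h1).const_mul (1 / 2))
  have txy := pd_inl_one (p := p) (F := fun x _ => 1 / 2 * (deriv (X 0) x / X 0 x))
    (hasDerivAt_const _ _)
  have tyx := pd_inl_zero (p := p) (F := fun _ y => 1 / 2 * (deriv (X 1) y / X 1 y))
    (hasDerivAt_const _ _)
  have gx := pd_inl_zero (p := p) (F := fun x y => X 0 x / (2 * (x - y) * X 1 y))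
    ((hd 0).hasDerivAt.div ((hux.const_mul 2).mul_const _) (mul_ne_zero h2u h1))
  have gy := pd_inl_one (p := p) (F := fun x y => -X 1 y / (2 * (x - y) * X 0 x))
    ((hd 1).hasDerivAt.neg.div ((huy.const_mul 2).mul_const _) (mul_ne_zero h2u h0))
  have dy := pd_inl_one (p := p) (F := fun x y => (1 / (x - y) - deriv (X 0) x / X 0 x) / 2)
    ((((hasDerivAt_const _ 1).div huy hu).sub_const _).div_const 2)
  have dx := pd_inl_zero (p := p) (F := fun x y => (-1 / (x - y) - deriv (X 1) y / X 1 y) / 2)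
    ((((hasDerivAt_const _ (-1)).div hux hu).sub_const _).div_const 2)
  rcases mul_self_eq_one_iff.1 hs with rfl | rfl <;> fin_cases m <;> fin_cases n <;>
  · simp [baseChristoffel, connectionMatrix, -one_div, -mul_inv_rev,
      mx, my, px, py, tx, ty, txy, tyx, gx, gy, dx, dy, ricciOne, ricciTwo]
    try field_simp
    try ring

end RicciBase

/-- A covector along the `ψ` directions, extended by zero. -/
def ext (v : Fin 3 → ℝ) : Coord 2 → ℝ := Sum.elim (fun _ => 0) v

/-! ### The five-dimensional frame. -/

section FullFrame

variable {s κ a : ℝ} {q : Fin 2 → ℝ} {x y : ℝ}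

/-- The five-dimensional form of `sum_frame_mul_dual`, in which `dx 0` and `dx 1` also serve as
their own dual vectors. All contractions of the field strength are instances of it. -/
theorem sum_fullFrame_mul_dual (hxy : x - y ≠ 0) (α β A B C α' β' P Q R : ℝ) :
    ∑ k, (α * dx 0 k + β * dx 1 k + A * ext (thetaForm y) k + B * ext (thetaForm x) k
        + C * ext (phi κ a (q 0) (q 1) x y) k)
      * (α' * dx 0 k + β' * dx 1 k + P * ext (dualOne κ a (q 0) x y) k
        + Q * ext (dualTwo κ a (q 1) x y) k + R * ext dualZero k)
      = α * α' + β * β' + A * P + B * Q + C * R := by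
  rw [Fintype.sum_sum_type]
  simp [dx, ext, sum_frame_mul_dual hxy]
  ring

theorem inverseMetric_apply (X : Fin 2 → ℝ → ℝ) (p : Coord 2 → ℝ) (i j : Coord 2) :
    inverseMetric X p s κ a q i j =
      X 0 (p (Sum.inl 0)) / (p (Sum.inl 0) - p (Sum.inl 1)) * (dx 0 i * dx 0 j)
      + -X 1 (p (Sum.inl 1)) / (p (Sum.inl 0) - p (Sum.inl 1)) * (dx 1 i * dx 1 j)
      + (p (Sum.inl 0) - p (Sum.inl 1)) / X 0 (p (Sum.inl 0))
        * (ext (dualOne κ a (q 0) (p (Sum.inl 0)) (p (Sum.inl 1))) i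
          * ext (dualOne κ a (q 0) (p (Sum.inl 0)) (p (Sum.inl 1))) j)
      + -(p (Sum.inl 0) - p (Sum.inl 1)) / X 1 (p (Sum.inl 1))
        * (ext (dualTwo κ a (q 1) (p (Sum.inl 0)) (p (Sum.inl 1))) i
          * ext (dualTwo κ a (q 1) (p (Sum.inl 0)) (p (Sum.inl 1))) j)
      + s / 4 * (ext dualZero i * ext dualZero j) := by
  rcases i with i | i <;> rcases j with j | j
  · rw [inverseMetric_inl_inl]
    fin_cases i <;> fin_cases j <;> simp [dx, ext, Q_zero, Q_one]
  · simp [inverseMetric_inl_inr, dx, ext]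
  · simp [inverseMetric_inr_inl, dx, ext]
  · simp [inverseMetric_inr_inr, dx, ext, fibreInverse]

theorem pd_eq {F : ℝ → ℝ → ℝ} {p : Coord 2 → ℝ} {F₁ F₂ : ℝ}
    (h₁ : HasDerivAt (fun t => F t (p (Sum.inl 1))) F₁ (p (Sum.inl 0)))
    (h₂ : HasDerivAt (fun t => F (p (Sum.inl 0)) t) F₂ (p (Sum.inl 1))) (k : Coord 2) :
    pd k (fun p : Coord 2 → ℝ => F (p (Sum.inl 0)) (p (Sum.inl 1))) p
      = dx 0 k * F₁ + dx 1 k * F₂ := by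
  rcases k with k | k
  · fin_cases k
    · simpa [dx] using pd_inl_zero h₁
    · simpa [dx] using pd_inl_one h₂
  · simpa [dx] using pd_inr k F p

theorem hasDerivAt_ext_thetaForm_y (hxy : x - y ≠ 0) (i : Coord 2) :
    HasDerivAt (fun t => ext (thetaForm t) i)
      ((x - y)⁻¹ * (ext (thetaForm x) i - ext (thetaForm y) i)) y := by
  rcases i with i | i
  · simpa [ext] using hasDerivAt_const y (0 : ℝ)
  · exact (hasDerivAt_thetaForm_y hxy i).congr_deriv (by simp [ext]; ring)

theorem hasDerivAt_ext_thetaForm_x (hxy : x - y ≠ 0) (i : Coord 2) :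
    HasDerivAt (fun t => ext (thetaForm t) i)
      ((x - y)⁻¹ * (ext (thetaForm x) i - ext (thetaForm y) i)) x := by
  rcases i with i | i
  · simpa [ext] using hasDerivAt_const x (0 : ℝ)
  · exact (hasDerivAt_thetaForm_x hxy i).congr_deriv (by simp [ext]; ring)

theorem hasDerivAt_ext_phi_x (hxy : x - y ≠ 0) (i : Coord 2) :
    HasDerivAt (fun t => ext (phi κ a (q 0) (q 1) t y) i)
      (torsionOne κ q x y * ext (thetaForm y) i) x := by
  rcases i with i | i
  · simpa [ext] using hasDerivAt_const x (0 : ℝ)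
  · exact hasDerivAt_phi_x hxy i

theorem hasDerivAt_ext_phi_y (hxy : x - y ≠ 0) (i : Coord 2) :
    HasDerivAt (fun t => ext (phi κ a (q 0) (q 1) x t) i)
      (torsionTwo κ q x y * ext (thetaForm x) i) y := by
  rcases i with i | i
  · simpa [ext] using hasDerivAt_const y (0 : ℝ)
  · exact hasDerivAt_phi_y hxy i

theorem baseForm_zero_eq (p : Coord 2 → ℝ) : baseForm 0 p = ext (thetaForm (p (Sum.inl 1))) := by
  funext i
  rcases i with i | i
  · rfl
  · exact baseForm_zero_inr p i

theorem baseForm_one_eq (p : Coord 2 → ℝ) : baseForm 1 p = ext (thetaForm (p (Sum.inl 0))) := by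
  funext i
  rcases i with i | i
  · rfl
  · exact baseForm_one_inr p i

theorem fiberForm_eq (p : Coord 2 → ℝ) : fiberForm (fun μ => quad κ a (q μ)) p
    = ext (phi κ a (q 0) (q 1) (p (Sum.inl 0)) (p (Sum.inl 1))) := by
  funext i
  rcases i with i | i
  · exact fiberForm_inl _ p i
  · exact fiberForm_inr p κ a q i

end FullFrame

/-! ### The field strength and its contractions. -/

section FieldStrength

variable {X : Fin 2 → ℝ → ℝ} {p : Coord 2 → ℝ} {s c κ a : ℝ} {q : Fin 2 → ℝ}

/-- The function `f` in `F = f (dx ∧ thetaForm y - dy ∧ thetaForm x)`. -/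
def fieldCoeff (c : ℝ) (q : Fin 2 → ℝ) (x y : ℝ) : ℝ := -c * (q 0 - q 1) / (x - y) ^ 2

/-- The components of `u ∧ v`. -/
def wedgeOne (u v : Coord 2 → ℝ) (i j : Coord 2) : ℝ := u i * v j - u j * v i

theorem gaugePotential_eq (i : Coord 2) : gaugePotential c q p i =
    c * ((q 0 * ext (thetaForm (p (Sum.inl 1))) i - q 1 * ext (thetaForm (p (Sum.inl 0))) i)
      / (p (Sum.inl 0) - p (Sum.inl 1))) := by
  rcases i with i | i
  · simp [gaugePotential, potential_inl, ext]
  · simp [gaugePotential, potential_inr, ext]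

theorem pd_gaugePotential (hu : p (Sum.inl 0) - p (Sum.inl 1) ≠ 0) (k i : Coord 2) :
    pd k (fun p => gaugePotential c q p i) p =
      fieldCoeff c q (p (Sum.inl 0)) (p (Sum.inl 1))
        * (dx 0 k * ext (thetaForm (p (Sum.inl 1))) i
          - dx 1 k * ext (thetaForm (p (Sum.inl 0))) i) := by
  simp only [gaugePotential_eq]
  rw [pd_eq (F := fun x y => c * ((q 0 * ext (thetaForm y) i - q 1 * ext (thetaForm x) i)
      / (x - y)))
    ((((hasDerivAt_const _ _).sub ((hasDerivAt_ext_thetaForm_x hu i).const_mul _)).div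
      ((hasDerivAt_id' _).sub_const _) hu).const_mul c)
    (((((hasDerivAt_ext_thetaForm_y hu i).const_mul _).sub (hasDerivAt_const _ _)).div
      ((hasDerivAt_id' _).const_sub _) hu).const_mul c)]
  simp only [fieldCoeff, Pi.sub_apply]
  field_simp
  ring

theorem extD_oneForm (A : (Coord 2 → ℝ) → Coord 2 → ℝ) (I : Fin 2 → Coord 2) :
    extD (oneForm A) p I = pd (I 0) (fun x => A x (I 1)) p - pd (I 1) (fun x => A x (I 0)) p := by
  simp [extD, oneForm, Fin.sum_univ_two, sub_eq_add_neg]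

theorem fieldStrength_eq (hu : p (Sum.inl 0) - p (Sum.inl 1) ≠ 0) (I : Fin 2 → Coord 2) :
    extD (oneForm (gaugePotential c q)) p I =
      fieldCoeff c q (p (Sum.inl 0)) (p (Sum.inl 1))
        * (wedgeOne (dx 0) (ext (thetaForm (p (Sum.inl 1)))) (I 0) (I 1)
          - wedgeOne (dx 1) (ext (thetaForm (p (Sum.inl 0)))) (I 0) (I 1)) := by
  rw [extD_oneForm, pd_gaugePotential hu, pd_gaugePotential hu, wedgeOne, wedgeOne]
  ring

variable (κ a) (hs : s * s = 1) (hp : p ∈ domain X)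
include hs hp

theorem sum_inv_mul_fieldStrength (i j : Coord 2) :
    ∑ l, (metricWithSign s X (fun μ => quad κ a (q μ)) p)⁻¹ i l
        * extD (oneForm (gaugePotential c q)) p ![j, l]
      = fieldCoeff c q (p (Sum.inl 0)) (p (Sum.inl 1)) *
        ((p (Sum.inl 0) - p (Sum.inl 1)) / X 0 (p (Sum.inl 0))
            * (dx 0 j * ext (dualOne κ a (q 0) (p (Sum.inl 0)) (p (Sum.inl 1))) i)
          - X 0 (p (Sum.inl 0)) / (p (Sum.inl 0) - p (Sum.inl 1))
            * (ext (thetaForm (p (Sum.inl 1))) j * dx 0 i)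
          - -(p (Sum.inl 0) - p (Sum.inl 1)) / X 1 (p (Sum.inl 1))
            * (dx 1 j * ext (dualTwo κ a (q 1) (p (Sum.inl 0)) (p (Sum.inl 1))) i)
          + -X 1 (p (Sum.inl 1)) / (p (Sum.inl 0) - p (Sum.inl 1))
            * (ext (thetaForm (p (Sum.inl 0))) j * dx 1 i)) := by
  have hu := sub_ne_zero_of_mem_domain hp
  simp only [metric_inv κ a q hs hp, inverseMetric_apply, fieldStrength_eq hu, wedgeOne,
    Matrix.cons_val]
  generalize p (Sum.inl 0) = x at *
  generalize p (Sum.inl 1) = y at *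
  -- The first five coefficients expand row `j` of the field strength, which has no leg along `phi`;
  -- the last five expand row `i` of the inverse metric.
  have key := sum_fullFrame_mul_dual (κ := κ) (a := a) (q := q) hu
    (-fieldCoeff c q x y * ext (thetaForm y) j) (fieldCoeff c q x y * ext (thetaForm x) j)
    (fieldCoeff c q x y * dx 0 j) (-fieldCoeff c q x y * dx 1 j) 0
    (X 0 x / (x - y) * dx 0 i) (-X 1 y / (x - y) * dx 1 i)
    ((x - y) / X 0 x * ext (dualOne κ a (q 0) x y) i)
    (-(x - y) / X 1 y * ext (dualTwo κ a (q 1) x y) i) (s / 4 * ext dualZero i)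
  refine (Eq.trans ?_ key).trans ?_
  · exact Finset.sum_congr rfl fun l _ => by ring
  · ring

/-- In the orthonormal coframe `F` is `f` times a difference of two orthogonal unit planes, so minus
its square is `f²` times the projection away from `e⁰`. -/
theorem contr_fieldStrength (i j : Coord 2) :
    contr (metricWithSign s X fun μ => quad κ a (q μ)) (extD (oneForm (gaugePotential c q))) i j p
      = fieldCoeff c q (p (Sum.inl 0)) (p (Sum.inl 1)) ^ 2 *
        ((p (Sum.inl 0) - p (Sum.inl 1)) / X 0 (p (Sum.inl 0)) * (dx 0 i * dx 0 j)
          + X 0 (p (Sum.inl 0)) / (p (Sum.inl 0) - p (Sum.inl 1))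
            * (ext (thetaForm (p (Sum.inl 1))) i * ext (thetaForm (p (Sum.inl 1))) j)
          + -(p (Sum.inl 0) - p (Sum.inl 1)) / X 1 (p (Sum.inl 1)) * (dx 1 i * dx 1 j)
          + -X 1 (p (Sum.inl 1)) / (p (Sum.inl 0) - p (Sum.inl 1))
            * (ext (thetaForm (p (Sum.inl 0))) i * ext (thetaForm (p (Sum.inl 0))) j)) := by
  have hu := sub_ne_zero_of_mem_domain hp
  have h (k : Coord 2) : ∑ l, (metricWithSign s X (fun μ => quad κ a (q μ)) p)⁻¹ k l
        * extD (oneForm (gaugePotential c q)) p ![i, k]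
        * extD (oneForm (gaugePotential c q)) p ![j, l]
      = extD (oneForm (gaugePotential c q)) p ![i, k]
        * ∑ l, (metricWithSign s X (fun μ => quad κ a (q μ)) p)⁻¹ k l
          * extD (oneForm (gaugePotential c q)) p ![j, l] := by
    rw [Finset.mul_sum]
    exact Finset.sum_congr rfl fun l _ => by ring
  simp only [contr, h, sum_inv_mul_fieldStrength κ a hs hp]
  simp only [fieldStrength_eq hu, wedgeOne, Matrix.cons_val]
  generalize p (Sum.inl 0) = x at *
  generalize p (Sum.inl 1) = y at *
  have key := sum_fullFrame_mul_dual (κ := κ) (a := a) (q := q) hu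
    (-fieldCoeff c q x y * ext (thetaForm y) i) (fieldCoeff c q x y * ext (thetaForm x) i)
    (fieldCoeff c q x y * dx 0 i) (-fieldCoeff c q x y * dx 1 i) 0
    (-fieldCoeff c q x y * (X 0 x / (x - y)) * ext (thetaForm y) j)
    (fieldCoeff c q x y * (-X 1 y / (x - y)) * ext (thetaForm x) j)
    (fieldCoeff c q x y * ((x - y) / X 0 x) * dx 0 j)
    (-fieldCoeff c q x y * (-(x - y) / X 1 y) * dx 1 j) 0
  refine (Eq.trans ?_ key).trans ?_
  · exact Finset.sum_congr rfl fun l _ => by ring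
  · ring

theorem raise_fieldStrength (i j : Coord 2) :
    raise (metricWithSign s X fun μ => quad κ a (q μ)) (extD (oneForm (gaugePotential c q))) i j p
      = fieldCoeff c q (p (Sum.inl 0)) (p (Sum.inl 1)) *
        (wedgeOne (dx 0) (ext (dualOne κ a (q 0) (p (Sum.inl 0)) (p (Sum.inl 1)))) i j
          - wedgeOne (dx 1) (ext (dualTwo κ a (q 1) (p (Sum.inl 0)) (p (Sum.inl 1)))) i j) := by
  have hu := sub_ne_zero_of_mem_domain hp
  have h0 := zero_ne_of_mem_domain hp
  have h1 := one_ne_of_mem_domain hp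
  simp only [raise, mul_assoc, ← Finset.mul_sum, sum_inv_mul_fieldStrength κ a hs hp]
  simp only [metric_inv κ a q hs hp, inverseMetric_apply, wedgeOne]
  generalize p (Sum.inl 0) = x at *
  generalize p (Sum.inl 1) = y at *
  have key := sum_fullFrame_mul_dual (κ := κ) (a := a) (q := q) hu
    (fieldCoeff c q x y * ((x - y) / X 0 x) * ext (dualOne κ a (q 0) x y) j)
    (-fieldCoeff c q x y * (-(x - y) / X 1 y) * ext (dualTwo κ a (q 1) x y) j)
    (-fieldCoeff c q x y * (X 0 x / (x - y)) * dx 0 j)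
    (fieldCoeff c q x y * (-X 1 y / (x - y)) * dx 1 j) 0
    (X 0 x / (x - y) * dx 0 i) (-X 1 y / (x - y) * dx 1 i)
    ((x - y) / X 0 x * ext (dualOne κ a (q 0) x y) i)
    (-(x - y) / X 1 y * ext (dualTwo κ a (q 1) x y) i) (s / 4 * ext dualZero i)
  refine (Eq.trans ?_ key).trans ?_
  · exact Finset.sum_congr rfl fun l _ => by ring
  · field_simp
    ring

theorem normSq_fieldStrength :
    normSq (metricWithSign s X fun μ => quad κ a (q μ)) (extD (oneForm (gaugePotential c q))) p
      = 4 * fieldCoeff c q (p (Sum.inl 0)) (p (Sum.inl 1)) ^ 2 := by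
  have hu := sub_ne_zero_of_mem_domain hp
  simp only [normSq, raise_fieldStrength κ a hs hp, fieldStrength_eq hu, wedgeOne, Matrix.cons_val]
  generalize p (Sum.inl 0) = x at *
  generalize p (Sum.inl 1) = y at *
  have key (k : Coord 2) := sum_fullFrame_mul_dual (κ := κ) (a := a) (q := q) hu
    (-fieldCoeff c q x y * ext (thetaForm y) k) (fieldCoeff c q x y * ext (thetaForm x) k)
    (fieldCoeff c q x y * dx 0 k) (-fieldCoeff c q x y * dx 1 k) 0
    (-fieldCoeff c q x y * ext (dualOne κ a (q 0) x y) k)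
    (fieldCoeff c q x y * ext (dualTwo κ a (q 1) x y) k)
    (fieldCoeff c q x y * dx 0 k) (-fieldCoeff c q x y * dx 1 k) 0
  -- Each of these four pairings equals `1`; together they are the trace of the projection onto the
  -- directions that `F` sees, the `4` in the result.
  have e1 := sum_fullFrame_mul_dual (κ := κ) (a := a) (q := q) hu 1 0 0 0 0 1 0 0 0 0
  have e2 := sum_fullFrame_mul_dual (κ := κ) (a := a) (q := q) hu 0 1 0 0 0 0 1 0 0 0
  have e3 := sum_fullFrame_mul_dual (κ := κ) (a := a) (q := q) hu 0 0 1 0 0 0 0 1 0 0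
  have e4 := sum_fullFrame_mul_dual (κ := κ) (a := a) (q := q) hu 0 0 0 1 0 0 0 0 1 0
  simp only [one_mul, zero_mul, zero_add, add_zero] at e1 e2 e3 e4
  have := congrArg (fieldCoeff c q x y ^ 2 * ·) (congrArg₂ (· + ·) (congrArg₂ (· + ·) e1 e2)
    (congrArg₂ (· + ·) e3 e4))
  simp only [← Finset.sum_add_distrib, Finset.mul_sum] at this
  refine (Finset.sum_congr rfl fun k _ => (Eq.trans ?_ (key k)).trans ?_).trans (this.trans ?_)
  · exact Finset.sum_congr rfl fun l _ => by ring
  · ring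
  · ring

end FieldStrength

/-! ### Contractions of the volume form as determinants. -/

section Determinant

/-- The components of `u ∧ v ∧ w`. -/
def wedgeThree (u v w : Coord 2 → ℝ) (i j k : Coord 2) : ℝ :=
  u i * (v j * w k - v k * w j) - u j * (v i * w k - v k * w i) + u k * (v i * w j - v j * w i)

theorem volForm_eq_det {ι : Type*} (θ : Fin 5 → (ι → ℝ) → ι → ℝ) (p : ι → ℝ)
    (i j : ι) (I : Fin 3 → ι) :
    volForm θ p (Matrix.vecCons i (Matrix.vecCons j I)) =
      Matrix.det (Matrix.of ![fun a => θ a p i, fun a => θ a p j,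
          fun a => θ a p (I 0), fun a => θ a p (I 1), fun a => θ a p (I 2)]) := by
  rw [volForm, ← Matrix.det_transpose]
  refine congrArg Matrix.det (Matrix.ext fun b a => ?_)
  fin_cases b
  · rfl
  · rfl
  · rfl
  · rfl
  · rfl

theorem det_sum_row_zero {ι : Type*} (s : Finset ι) (u : ι → ℝ) (c : ι → Fin 5 → ℝ)
    (r₁ r₂ r₃ r₄ : Fin 5 → ℝ) :
    Matrix.det (Matrix.of ![fun a => ∑ i ∈ s, u i * c i a, r₁, r₂, r₃, r₄])
      = ∑ i ∈ s, u i * Matrix.det (Matrix.of ![c i, r₁, r₂, r₃, r₄]) := by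
  have h (r : Fin 5 → ℝ) : Matrix.det (Matrix.of ![r, r₁, r₂, r₃, r₄])
      = ∑ a, r a * ((-1) ^ (a : ℕ) * Matrix.det ((Matrix.of ![r₁, r₂, r₃, r₄]).submatrix id
        a.succAbove)) := by
    rw [Matrix.det_succ_row_zero]
    refine Finset.sum_congr rfl fun a _ => ?_
    have : (Matrix.of ![r, r₁, r₂, r₃, r₄]).submatrix Fin.succ a.succAbove
      = (Matrix.of ![r₁, r₂, r₃, r₄]).submatrix id a.succAbove := by
      ext i j; rfl
    rw [this, Matrix.of_apply, Matrix.cons_val_zero]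
    ring
  simp only [h, Finset.sum_mul, Finset.mul_sum]
  rw [Finset.sum_comm]
  simp only [mul_assoc]

theorem det_swap_rows (r₀ r₁ r₂ r₃ r₄ : Fin 5 → ℝ) :
    Matrix.det (Matrix.of ![r₀, r₁, r₂, r₃, r₄])
      = -Matrix.det (Matrix.of ![r₁, r₀, r₂, r₃, r₄]) := by
  have h : Matrix.of ![r₀, r₁, r₂, r₃, r₄]
      = (Matrix.of ![r₁, r₀, r₂, r₃, r₄]).submatrix (Equiv.swap (0 : Fin 5) 1) id := by
    ext i j
    fin_cases i <;> rfl
  rw [h, Matrix.det_permute, Equiv.Perm.sign_swap (by decide)]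
  simp

/-- Multilinearity in the first two slots: inserting `u` and `v` replaces two rows of the
determinant by the coframe components of `u` and `v`. This avoids summing over coordinate indices in
the Hodge dual. -/
theorem sum_mul_volForm {ι : Type*} [Fintype ι] (θ : Fin 5 → (ι → ℝ) → ι → ℝ) (p : ι → ℝ)
    (u v : ι → ℝ) (I : Fin 3 → ι) :
    ∑ i, ∑ j, u i * v j * volForm θ p (Matrix.vecCons i (Matrix.vecCons j I))
      = Matrix.det (Matrix.of ![fun a => ∑ i, u i * θ a p i, fun a => ∑ i, v i * θ a p i,
          fun a => θ a p (I 0), fun a => θ a p (I 1), fun a => θ a p (I 2)]) := by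
  rw [det_sum_row_zero _ _ fun i a => θ a p i]
  refine Finset.sum_congr rfl fun i _ => ?_
  rw [det_swap_rows, det_sum_row_zero _ _ fun i a => θ a p i, ← Finset.sum_neg_distrib,
    Finset.mul_sum]
  refine Finset.sum_congr rfl fun j _ => ?_
  rw [volForm_eq_det, det_swap_rows]
  ring

theorem det_rows_zero_one (w v : ℝ) (r₂ r₃ r₄ : Fin 5 → ℝ) :
    Matrix.det (Matrix.of ![![w, 0, 0, 0, 0], ![0, v, 0, 0, 0], r₂, r₃, r₄])
      = w * v * (r₂ 2 * (r₃ 3 * r₄ 4 - r₃ 4 * r₄ 3) - r₃ 2 * (r₂ 3 * r₄ 4 - r₂ 4 * r₄ 3)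
        + r₄ 2 * (r₂ 3 * r₃ 4 - r₂ 4 * r₃ 3)) := by
  simp [Matrix.det_succ_row_zero, Fin.sum_univ_succ, Fin.succAbove]
  ring

theorem det_rows_two_three (w v : ℝ) (r₂ r₃ r₄ : Fin 5 → ℝ) :
    Matrix.det (Matrix.of ![![0, 0, w, 0, 0], ![0, 0, 0, v, 0], r₂, r₃, r₄])
      = w * v * (r₂ 0 * (r₃ 1 * r₄ 4 - r₃ 4 * r₄ 1) - r₃ 0 * (r₂ 1 * r₄ 4 - r₂ 4 * r₄ 1)
        + r₄ 0 * (r₂ 1 * r₃ 4 - r₂ 4 * r₃ 1)) := by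
  simp [Matrix.det_succ_row_zero, Fin.sum_univ_succ, Fin.succAbove]
  ring

end Determinant

/-! ### The Hodge dual of the field strength. -/

section Hodge

variable {X : Fin 2 → ℝ → ℝ} {p : Coord 2 → ℝ} {s c κ a : ℝ} {q : Fin 2 → ℝ}

/-- The Hodge dual of the field strength. -/
def dualField (c κ a : ℝ) (q : Fin 2 → ℝ) (i j k : Coord 2) (x y : ℝ) : ℝ :=
  2 * fieldCoeff c q x y *
    (wedgeThree (dx 1) (ext (thetaForm x)) (ext (phi κ a (q 0) (q 1) x y)) i j k
      - wedgeThree (dx 0) (ext (thetaForm y)) (ext (phi κ a (q 0) (q 1) x y)) i j k)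

/-- Raised, `F` is spanned by the two planes of vectors dual to `e^μ, ê^μ`. Inserting one plane in
the volume form leaves the other three legs; the factors `√Q_μ` cancel within each plane, and the
`2` comes from `e⁰ = 2 φ`. -/
theorem hodge_fieldStrength (hs : s * s = 1) (hp : p ∈ domain X) (I : Fin 3 → Coord 2) :
    hodge (metricWithSign s X fun μ => quad κ a (q μ))
        (volForm (coframe X fun μ => quad κ a (q μ))) (extD (oneForm (gaugePotential c q))) p I
      = dualField c κ a q (I 0) (I 1) (I 2) (p (Sum.inl 0)) (p (Sum.inl 1)) := by
  have hu := sub_ne_zero_of_mem_domain hp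
  have hq0 := (Real.sqrt_pos.2 (hp.2 0)).ne'
  have hq1 := (Real.sqrt_pos.2 (hp.2 1)).ne'
  have key := sum_fullFrame_mul_dual (κ := κ) (a := a) (q := q) hu
  have split (f : ℝ) (u v u' v' : Coord 2 → ℝ) (i j : Coord 2) (w : ℝ) :
      f * (wedgeOne u v i j - wedgeOne u' v' i j) * w
        = f * (u i * v j * w - v i * u j * w - (u' i * v' j * w - v' i * u' j * w)) := by
    simp only [wedgeOne]; ring
  simp only [hodge, raise_fieldStrength κ a hs hp, split, ← Finset.mul_sum,
    Finset.sum_sub_distrib, sum_mul_volForm]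
  have c0 : ∀ a', ∑ i, dx 0 i * coframe X (fun μ => quad κ a (q μ)) a' p i
      = ![(√(Q X (xs p) 0))⁻¹, 0, 0, 0, 0] a' := by
    intro a'
    rw [Fintype.sum_sum_type]
    fin_cases a' <;> simp [coframe, e, eHat, eZero, dx, fiberForm_inl, baseForm_inl]
  have c1 : ∀ a', ∑ i, dx 1 i * coframe X (fun μ => quad κ a (q μ)) a' p i
      = ![0, 0, (√(Q X (xs p) 1))⁻¹, 0, 0] a' := by
    intro a'
    rw [Fintype.sum_sum_type]
    fin_cases a' <;> simp [coframe, e, eHat, eZero, dx, fiberForm_inl, baseForm_inl]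
  have v0 : ∀ a', ∑ i, ext (dualOne κ a (q 0) (p (Sum.inl 0)) (p (Sum.inl 1))) i
        * coframe X (fun μ => quad κ a (q μ)) a' p i
      = ![0, √(Q X (xs p) 0), 0, 0, 0] a' := by
    intro a'
    have k1 := key 0 0 (√(Q X (xs p) 0)) 0 0 0 0 1 0 0
    have k2 := key 0 0 0 (√(Q X (xs p) 1)) 0 0 0 1 0 0
    have k3 := key 0 0 0 0 2 0 0 1 0 0
    simp only [zero_mul, mul_zero, one_mul, mul_one, add_zero, zero_add] at k1 k2 k3
    fin_cases a'
    · simp [coframe, e, dx, ext]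
    · simpa [coframe, eHat, baseForm_zero_eq, mul_comm] using k1
    · simp [coframe, e, dx, ext]
    · simpa [coframe, eHat, baseForm_one_eq, mul_comm] using k2
    · simpa [coframe, eZero, fiberForm_eq, mul_comm] using k3
  have v1 : ∀ a', ∑ i, ext (dualTwo κ a (q 1) (p (Sum.inl 0)) (p (Sum.inl 1))) i
        * coframe X (fun μ => quad κ a (q μ)) a' p i
      = ![0, 0, 0, √(Q X (xs p) 1), 0] a' := by
    intro a'
    have k1 := key 0 0 (√(Q X (xs p) 0)) 0 0 0 0 0 1 0
    have k2 := key 0 0 0 (√(Q X (xs p) 1)) 0 0 0 0 1 0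
    have k3 := key 0 0 0 0 2 0 0 0 1 0
    simp only [zero_mul, mul_zero, one_mul, mul_one, add_zero, zero_add] at k1 k2 k3
    fin_cases a'
    · simp [coframe, e, dx, ext]
    · simpa [coframe, eHat, baseForm_zero_eq, mul_comm] using k1
    · simp [coframe, e, dx, ext]
    · simpa [coframe, eHat, baseForm_one_eq, mul_comm] using k2
    · simpa [coframe, eZero, fiberForm_eq, mul_comm] using k3
  rw [funext c0, funext c1, funext v0, funext v1, det_swap_rows ![0, _, 0, 0, 0],
    det_swap_rows ![0, 0, 0, _, 0]]
  simp only [det_rows_zero_one, det_rows_two_three]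
  simp only [coframe, Matrix.cons_val, e, eHat, eZero, baseForm_zero_eq, baseForm_one_eq,
    fiberForm_eq, dualField, wedgeThree]
  field_simp
  ring

end Hodge

/-! ### Maxwell's equation. -/

section Maxwell

variable {X : Fin 2 → ℝ → ℝ} {D : Set (Coord 2 → ℝ)} {p : Coord 2 → ℝ} {s c κ a x y : ℝ}
  {q : Fin 2 → ℝ}

theorem hasDerivAt_fieldCoeff_x (hxy : x - y ≠ 0) : HasDerivAt (fun t => fieldCoeff c q t y)
    (-2 * (x - y)⁻¹ * fieldCoeff c q x y) x := by
  have h := (hasDerivAt_const x (-c * (q 0 - q 1))).div (((hasDerivAt_id' x).sub_const y).pow 2)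
    (pow_ne_zero 2 hxy)
  refine h.congr_deriv ?_
  simp only [fieldCoeff, Pi.pow_apply]
  field_simp
  ring

theorem hasDerivAt_fieldCoeff_y (hxy : x - y ≠ 0) : HasDerivAt (fun t => fieldCoeff c q x t)
    (2 * (x - y)⁻¹ * fieldCoeff c q x y) y := by
  have h := (hasDerivAt_const y (-c * (q 0 - q 1))).div (((hasDerivAt_id' y).const_sub x).pow 2)
    (pow_ne_zero 2 hxy)
  refine h.congr_deriv ?_
  simp only [fieldCoeff, Pi.pow_apply]
  field_simp
  ring

theorem hasDerivAt_wedgeThree {u v w : ℝ → Coord 2 → ℝ} {u' v' w' : Coord 2 → ℝ} {t : ℝ}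
    (hu : ∀ i, HasDerivAt (fun t => u t i) (u' i) t) (hv : ∀ i, HasDerivAt (fun t => v t i) (v' i) t)
    (hw : ∀ i, HasDerivAt (fun t => w t i) (w' i) t) (i j k : Coord 2) :
    HasDerivAt (fun t => wedgeThree (u t) (v t) (w t) i j k)
      (wedgeThree u' (v t) (w t) i j k + wedgeThree (u t) v' (w t) i j k
        + wedgeThree (u t) (v t) w' i j k) t := by
  have h := (((hu i).mul (((hv j).mul (hw k)).sub ((hv k).mul (hw j)))).sub
    ((hu j).mul (((hv i).mul (hw k)).sub ((hv k).mul (hw i))))).add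
    ((hu k).mul (((hv i).mul (hw j)).sub ((hv j).mul (hw i))))
  refine h.congr_deriv ?_
  simp only [wedgeThree, Pi.mul_apply, Pi.sub_apply]
  ring

theorem hasDerivAt_dualField_x (hxy : x - y ≠ 0) (i j k : Coord 2) :
    HasDerivAt (fun t => dualField c κ a q i j k t y)
      (-2 * (x - y)⁻¹ * dualField c κ a q i j k x y + 2 * fieldCoeff c q x y *
        ((x - y)⁻¹ * wedgeThree (dx 1) (fun l => ext (thetaForm x) l - ext (thetaForm y) l)
          (ext (phi κ a (q 0) (q 1) x y)) i j k
        + torsionOne κ q x y * wedgeThree (dx 1) (ext (thetaForm x)) (ext (thetaForm y)) i j k)) x := by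
  have h := ((hasDerivAt_fieldCoeff_x (c := c) (q := q) hxy).const_mul 2).mul
    ((hasDerivAt_wedgeThree (fun i => hasDerivAt_const x (dx 1 i))
      (hasDerivAt_ext_thetaForm_x hxy)
      (hasDerivAt_ext_phi_x (κ := κ) (a := a) (q := q) hxy) i j k).sub
    (hasDerivAt_wedgeThree (fun i => hasDerivAt_const x (dx 0 i))
      (fun i => hasDerivAt_const x (ext (thetaForm y) i))
      (hasDerivAt_ext_phi_x (κ := κ) (a := a) (q := q) hxy) i j k))
  refine h.congr_deriv ?_
  simp only [dualField, wedgeThree, Pi.sub_apply]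
  ring

theorem hasDerivAt_dualField_y (hxy : x - y ≠ 0) (i j k : Coord 2) :
    HasDerivAt (fun t => dualField c κ a q i j k x t)
      (2 * (x - y)⁻¹ * dualField c κ a q i j k x y - 2 * fieldCoeff c q x y *
        ((x - y)⁻¹ * wedgeThree (dx 0) (fun l => ext (thetaForm x) l - ext (thetaForm y) l)
          (ext (phi κ a (q 0) (q 1) x y)) i j k
        + torsionTwo κ q x y * wedgeThree (dx 0) (ext (thetaForm y)) (ext (thetaForm x)) i j k)) y := by
  have h := ((hasDerivAt_fieldCoeff_y (c := c) (q := q) hxy).const_mul 2).mul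
    ((hasDerivAt_wedgeThree (fun i => hasDerivAt_const y (dx 1 i))
      (fun i => hasDerivAt_const y (ext (thetaForm x) i))
      (hasDerivAt_ext_phi_y (κ := κ) (a := a) (q := q) hxy) i j k).sub
    (hasDerivAt_wedgeThree (fun i => hasDerivAt_const y (dx 0 i))
      (hasDerivAt_ext_thetaForm_y hxy)
      (hasDerivAt_ext_phi_y (κ := κ) (a := a) (q := q) hxy) i j k))
  refine h.congr_deriv ?_
  simp only [dualField, wedgeThree, Pi.sub_apply]
  ring

theorem extD_three (w : FormField (Coord 2) 3) (I : Fin 4 → Coord 2) :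
    extD w p I = pd (I 0) (fun x => w x ![I 1, I 2, I 3]) p
      - pd (I 1) (fun x => w x ![I 0, I 2, I 3]) p
      + pd (I 2) (fun x => w x ![I 0, I 1, I 3]) p
      - pd (I 3) (fun x => w x ![I 0, I 1, I 2]) p := by
  have h0 : I ∘ (0 : Fin 4).succAbove = ![I 1, I 2, I 3] := by funext b; fin_cases b <;> rfl
  have h1 : I ∘ (1 : Fin 4).succAbove = ![I 0, I 2, I 3] := by funext b; fin_cases b <;> rfl
  have h2 : I ∘ (2 : Fin 4).succAbove = ![I 0, I 1, I 3] := by funext b; fin_cases b <;> rfl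
  have h3 : I ∘ (3 : Fin 4).succAbove = ![I 0, I 1, I 2] := by funext b; fin_cases b <;> rfl
  refine (Fin.sum_univ_four _).trans ?_
  rw [h0, h1, h2, h3]
  norm_num
  ring

/-- The Hodge dual is `-2 F ∧ φ` with `F` closed, so its exterior derivative is `-2 F ∧ dφ`. Both
this and `F ∧ F` are multiples of one `4`-form, which leaves a scalar factor. -/
theorem maxwell_fieldStrength (hs : s * s = 1) (hD : RegularOn X D) (hp : p ∈ D)
    (I : Fin 4 → Coord 2) :
    extD (hodge (metricWithSign s X fun μ => quad κ a (q μ))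
        (volForm (coframe X fun μ => quad κ a (q μ))) (extD (oneForm (gaugePotential c q)))) p I
      - (1 / √3) * wedge (extD (oneForm (gaugePotential c q)))
        (extD (oneForm (gaugePotential c q))) p I
      = (2 / √3 * fieldCoeff c q (p (Sum.inl 0)) (p (Sum.inl 1)) ^ 2
        - 2 * fieldCoeff c q (p (Sum.inl 0)) (p (Sum.inl 1))
          * (torsionTwo κ q (p (Sum.inl 0)) (p (Sum.inl 1))
            - torsionOne κ q (p (Sum.inl 0)) (p (Sum.inl 1))))
        * wedge
          (fun p J => wedgeOne (dx 0) (ext (thetaForm (p (Sum.inl 1)))) (J 0) (J 1))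
          (fun p J => wedgeOne (dx 1) (ext (thetaForm (p (Sum.inl 0)))) (J 0) (J 1)) p I := by
  have hu := sub_ne_zero_of_mem_domain (hD.subset hp)
  have h (l : Coord 2) (J : Fin 3 → Coord 2) :
      pd l (fun x => hodge (metricWithSign s X fun μ => quad κ a (q μ))
        (volForm (coframe X fun μ => quad κ a (q μ)))
        (extD (oneForm (gaugePotential c q))) x J) p = _ :=
    (pd_congr hD.isOpen hp (fun p' hp' => hodge_fieldStrength hs (hD.subset hp') J) l).trans
      (pd_eq (hasDerivAt_dualField_x hu _ _ _) (hasDerivAt_dualField_y hu _ _ _) l)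
  simp only [extD_three, h, wedge, fieldStrength_eq hu, Matrix.cons_val]
  simp only [dualField, wedgeThree, wedgeOne]
  generalize p (Sum.inl 0) = x at *
  generalize p (Sum.inl 1) = y at *
  generalize ext (phi κ a (q 0) (q 1) x y) = φ
  generalize ext (thetaForm y) = θ₁
  generalize ext (thetaForm x) = θ₂
  generalize torsionOne κ q x y = α
  generalize torsionTwo κ q x y = β
  generalize fieldCoeff c q x y = f
  -- The derivatives were stated through `(x - y)⁻¹` and `fieldCoeff` itself, so the claim is a
  -- polynomial identity; the terms in `w` cancel because `F` is closed.
  generalize (x - y)⁻¹ = w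
  ring

end Maxwell

/-! ### Reduction of the field equations to scalar identities. -/

section Solutions

variable {X : Fin 2 → ℝ → ℝ} {D : Set (Coord 2 → ℝ)} {p : Coord 2 → ℝ} {s c κ a Λ : ℝ}
  {q : Fin 2 → ℝ}

theorem metric_eq (i j : Coord 2) :
    metricWithSign s X (fun μ => quad κ a (q μ)) p i j =
      (p (Sum.inl 0) - p (Sum.inl 1)) / X 0 (p (Sum.inl 0)) * (dx 0 i * dx 0 j)
      + X 0 (p (Sum.inl 0)) / (p (Sum.inl 0) - p (Sum.inl 1))
        * (ext (thetaForm (p (Sum.inl 1))) i * ext (thetaForm (p (Sum.inl 1))) j)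
      + -(p (Sum.inl 0) - p (Sum.inl 1)) / X 1 (p (Sum.inl 1)) * (dx 1 i * dx 1 j)
      + -X 1 (p (Sum.inl 1)) / (p (Sum.inl 0) - p (Sum.inl 1))
        * (ext (thetaForm (p (Sum.inl 0))) i * ext (thetaForm (p (Sum.inl 0))) j)
      + 4 * s * (ext (phi κ a (q 0) (q 1) (p (Sum.inl 0)) (p (Sum.inl 1))) i
        * ext (phi κ a (q 0) (q 1) (p (Sum.inl 0)) (p (Sum.inl 1))) j) := by
  simp only [metricWithSign, Matrix.of_apply, Fin.sum_univ_two, Q_zero, Q_one, baseForm_zero_eq,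
    baseForm_one_eq, fiberForm_eq, div_div_eq_mul_div]
  ring

theorem ricci_eq (hs : s * s = 1) (hD : RegularOn X D) (hp : p ∈ D) (i j : Coord 2) :
    ricci (metricWithSign s X fun μ => quad κ a (q μ)) i j p =
      ricciOne s κ q X (p (Sum.inl 0)) (p (Sum.inl 1)) *
        ((p (Sum.inl 0) - p (Sum.inl 1)) / X 0 (p (Sum.inl 0)) * (dx 0 i * dx 0 j)
        + X 0 (p (Sum.inl 0)) / (p (Sum.inl 0) - p (Sum.inl 1))
          * (ext (thetaForm (p (Sum.inl 1))) i * ext (thetaForm (p (Sum.inl 1))) j))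
      + ricciTwo s κ q X (p (Sum.inl 0)) (p (Sum.inl 1)) *
        (-(p (Sum.inl 0) - p (Sum.inl 1)) / X 1 (p (Sum.inl 1)) * (dx 1 i * dx 1 j)
        + -X 1 (p (Sum.inl 1)) / (p (Sum.inl 0) - p (Sum.inl 1))
          * (ext (thetaForm (p (Sum.inl 0))) i * ext (thetaForm (p (Sum.inl 0))) j))
      + ricciZero κ q (p (Sum.inl 0)) (p (Sum.inl 1)) *
        (4 * (ext (phi κ a (q 0) (q 1) (p (Sum.inl 0)) (p (Sum.inl 1))) i
          * ext (phi κ a (q 0) (q 1) (p (Sum.inl 0)) (p (Sum.inl 1))) j)) := by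
  rcases i with i | i <;> rcases j with j | j
  · rw [ricci_inl_inl κ a q hs hD hp]
    fin_cases i <;> fin_cases j <;> simp [dx, ext]
  · simp [ricci_inl_inr κ a q hs hD hp, dx, ext]
  · simp [ricci_inr_inl κ a q hs hD hp, dx, ext]
  · simp [ricci_inr_inr κ a q hs hD hp, dx, ext]

theorem contDiffAt_Q (hD : RegularOn X D) (hp : p ∈ D) (μ : Fin 2) :
    ContDiffAt ℝ 2 (fun x : Coord 2 → ℝ => Q X (xs x) μ) p := by
  have hu := sub_ne_zero_of_mem_domain (hD.subset hp)
  have hc (i : Coord 2) : ContDiffAt ℝ 2 (fun x : Coord 2 → ℝ => x i) p :=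
    (contDiff_apply ℝ ℝ i).contDiffAt
  have hX (μ : Fin 2) : ContDiffAt ℝ 2 (fun x : Coord 2 → ℝ => X μ (x (Sum.inl μ))) p :=
    (hD.contDiffAt p hp μ).comp p (hc (Sum.inl μ))
  fin_cases μ
  · simp only [Fin.zero_eta, Q_zero]
    exact (hX 0).div ((hc _).sub (hc _)) hu
  · simp only [Fin.mk_one, Q_one]
    exact (hX 1).neg.div ((hc _).sub (hc _)) hu

theorem contDiffAt_sqrt_Q (hD : RegularOn X D) (hp : p ∈ D) (μ : Fin 2) :
    ContDiffAt ℝ 2 (fun x : Coord 2 → ℝ => √(Q X (xs x) μ)) p :=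
  (contDiffAt_Q hD hp μ).sqrt ((hD.subset hp).2 μ).ne'

theorem contDiffAt_ext_thetaForm (μ : Fin 2) (i : Coord 2) :
    ContDiffAt ℝ 2 (fun x : Coord 2 → ℝ => ext (thetaForm (x (Sum.inl μ))) i) p := by
  rcases i with i | i
  · exact contDiffAt_const
  · simp only [ext, Sum.elim_inr, thetaForm]
    fin_cases i <;> simp <;> fun_prop

theorem contDiffAt_ext_phi (hD : RegularOn X D) (hp : p ∈ D) (i : Coord 2) :
    ContDiffAt ℝ 2 (fun x : Coord 2 → ℝ =>
      ext (phi κ a (q 0) (q 1) (x (Sum.inl 0)) (x (Sum.inl 1))) i) p := by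
  have hu := sub_ne_zero_of_mem_domain (hD.subset hp)
  rcases i with i | i
  · exact contDiffAt_const
  · simp only [ext, Sum.elim_inr, phi, thetaForm, quad]
    fin_cases i <;> simp <;> fun_prop (disch := assumption)

theorem contDiffAt_gaugePotential (hD : RegularOn X D) (hp : p ∈ D) (i : Coord 2) :
    ContDiffAt ℝ 2 (fun x => gaugePotential c q x i) p := by
  have hu := sub_ne_zero_of_mem_domain (hD.subset hp)
  have h0 := contDiffAt_ext_thetaForm (p := p) 0 i
  have h1 := contDiffAt_ext_thetaForm (p := p) 1 i
  simp only [gaugePotential_eq]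
  fun_prop (disch := assumption)

theorem contDiffAt_coframe (hD : RegularOn X D) (hp : p ∈ D) (b : Fin 5) (i : Coord 2) :
    ContDiffAt ℝ 2 (fun x => coframe X (fun μ => quad κ a (q μ)) b x i) p := by
  have hq (μ : Fin 2) : √(Q X (xs p) μ) ≠ 0 := (Real.sqrt_pos.2 ((hD.subset hp).2 μ)).ne'
  fin_cases b
  · exact contDiffAt_const.div (contDiffAt_sqrt_Q hD hp 0) (hq 0)
  · simpa [coframe, eHat, baseForm_zero_eq] using
      (contDiffAt_sqrt_Q hD hp 0).mul (contDiffAt_ext_thetaForm 1 i)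
  · exact contDiffAt_const.div (contDiffAt_sqrt_Q hD hp 1) (hq 1)
  · simpa [coframe, eHat, baseForm_one_eq] using
      (contDiffAt_sqrt_Q hD hp 1).mul (contDiffAt_ext_thetaForm 0 i)
  · simpa [coframe, eZero, fiberForm_eq] using
      contDiffAt_const.mul (contDiffAt_ext_phi (κ := κ) (a := a) (q := q) hD hp i)

theorem linearIndependent_coframe (hp : p ∈ domain X) :
    LinearIndependent ℝ fun b => coframe X (fun μ => quad κ a (q μ)) b p := by
  have hu := sub_ne_zero_of_mem_domain hp
  have hq (μ : Fin 2) : √(Q X (xs p) μ) ≠ 0 := (Real.sqrt_pos.2 (hp.2 μ)).ne'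
  rw [Fintype.linearIndependent_iff]
  intro g hg
  have h (i : Coord 2) := congrFun hg i
  simp only [Finset.sum_apply, Pi.smul_apply, smul_eq_mul, Fin.sum_univ_five, coframe,
    Matrix.cons_val, e, eHat, eZero, baseForm_zero_eq, baseForm_one_eq, fiberForm_eq,
    Pi.zero_apply] at h
  have h0 : g 0 = 0 := by simpa [dx, ext, hq] using h (Sum.inl 0)
  have h2 : g 2 = 0 := by simpa [dx, ext, hq] using h (Sum.inl 1)
  have h4 : g 4 = 0 := by simpa [dx, ext, phi, thetaForm] using h (Sum.inr 0)
  have k1 : g 1 * √(Q X (xs p) 0) + g 3 * √(Q X (xs p) 1) = 0 := by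
    simpa [dx, ext, thetaForm, h4] using h (Sum.inr 1)
  have k2 : g 1 * (√(Q X (xs p) 0) * p (Sum.inl 1))
      + g 3 * (√(Q X (xs p) 1) * p (Sum.inl 0)) = 0 := by
    simpa [dx, ext, thetaForm, h4] using h (Sum.inr 2)
  have h3 : g 3 = 0 := by
    have : g 3 * (√(Q X (xs p) 1) * (p (Sum.inl 0) - p (Sum.inl 1))) = 0 := by
      linear_combination k2 - p (Sum.inl 1) * k1
    exact (mul_eq_zero.1 this).resolve_right (mul_ne_zero (hq 1) hu)
  have h1 : g 1 = 0 := by simpa [h3, hq] using k1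
  intro b
  fin_cases b <;> assumption

theorem orthonormal_coframe (hp : p ∈ domain X) (i j : Coord 2) :
    metricWithSign s X (fun μ => quad κ a (q μ)) p i j
      = ∑ b, (![1, 1, 1, 1, s] : Fin 5 → ℝ) b * coframe X (fun μ => quad κ a (q μ)) b p i
        * coframe X (fun μ => quad κ a (q μ)) b p j := by
  have hq (μ : Fin 2) : √(Q X (xs p) μ) ^ 2 = Q X (xs p) μ := Real.sq_sqrt (hp.2 μ).le
  simp only [Fin.sum_univ_five, coframe, Matrix.cons_val, e, eHat, eZero, metricWithSign,
    Matrix.of_apply, Fin.sum_univ_two]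
  rw [← hq 0, ← hq 1]
  simp only [Real.sqrt_sq (Real.sqrt_nonneg _)]
  ring

/-- `1/6` is half of `1 - 4/6`, and `-1/3` is half of `-4/6`, since `F² = 4 f²` and the contraction
has no `e⁰` component. `ricciZero` multiplies `4 φ²` while the metric contains `4 s φ²`; hence `h₀`
carries no `s`. -/
theorem isSugraSolution_of_scalar (hs : s * s = 1) (hD : RegularOn X D)
    (h₁ : ∀ p ∈ D, ricciOne s κ q X (p (Sum.inl 0)) (p (Sum.inl 1))
      = -s * (Λ / 3 + fieldCoeff c q (p (Sum.inl 0)) (p (Sum.inl 1)) ^ 2 / 6))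
    (h₂ : ∀ p ∈ D, ricciTwo s κ q X (p (Sum.inl 0)) (p (Sum.inl 1))
      = -s * (Λ / 3 + fieldCoeff c q (p (Sum.inl 0)) (p (Sum.inl 1)) ^ 2 / 6))
    (h₀ : ∀ p ∈ D, ricciZero κ q (p (Sum.inl 0)) (p (Sum.inl 1))
      = -(Λ / 3 - fieldCoeff c q (p (Sum.inl 0)) (p (Sum.inl 1)) ^ 2 / 3))
    (hF : ∀ p ∈ D, fieldCoeff c q (p (Sum.inl 0)) (p (Sum.inl 1))
      = √3 * (torsionTwo κ q (p (Sum.inl 0)) (p (Sum.inl 1))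
        - torsionOne κ q (p (Sum.inl 0)) (p (Sum.inl 1)))) :
    IsSugraSolution s Λ (coframe X fun μ => quad κ a (q μ))
      (metricWithSign s X fun μ => quad κ a (q μ)) (gaugePotential c q) D where
  isOpen := hD.isOpen
  contDiff_coframe p hp := contDiffAt_coframe hD hp
  contDiff_potential p hp := contDiffAt_gaugePotential hD hp
  coframe_independent p hp := linearIndependent_coframe (hD.subset hp)
  orthonormal p hp := orthonormal_coframe (hD.subset hp)
  einstein p hp i j := by
    rw [ricci_eq hs hD hp, metric_eq, contr_fieldStrength κ a hs (hD.subset hp),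
      normSq_fieldStrength κ a hs (hD.subset hp), h₁ p hp, h₂ p hp, h₀ p hp]
    linear_combination (4 * (-(Λ / 3 - fieldCoeff c q (p (Sum.inl 0)) (p (Sum.inl 1)) ^ 2 / 3))
      * -(ext (phi κ a (q 0) (q 1) (p (Sum.inl 0)) (p (Sum.inl 1))) i
          * ext (phi κ a (q 0) (q 1) (p (Sum.inl 0)) (p (Sum.inl 1))) j)) * hs
  maxwell p hp I := by
    rw [maxwell_fieldStrength hs hD hp, hF p hp]
    have h3 : √3 ≠ 0 := by positivity
    field_simp
    ring

theorem regularOn_domain (hX : ∀ μ, ContDiff ℝ 2 (X μ)) : RegularOn X (domain X) where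
  isOpen := by
    rw [isOpen_iff_mem_nhds]
    intro p hp
    have hu := sub_ne_zero_of_mem_domain hp
    have hc (μ : Fin 2) : ContinuousAt (fun x : Coord 2 → ℝ => X μ (x (Sum.inl μ))) p :=
      ((hX μ).continuous.comp (continuous_apply _)).continuousAt
    have hd : ContinuousAt (fun x : Coord 2 → ℝ => x (Sum.inl 0) - x (Sum.inl 1)) p := by
      fun_prop
    have e0 : ContinuousAt (fun x : Coord 2 → ℝ => Q X (xs x) 0) p := by
      simp only [Q_zero]
      exact (hc 0).div hd hu
    have e1 : ContinuousAt (fun x : Coord 2 → ℝ => Q X (xs x) 1) p := by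
      simp only [Q_one]
      exact (hc 1).neg.div hd hu
    filter_upwards [e0.eventually_const_lt (hp.2 0), e1.eventually_const_lt (hp.2 1),
      hd.eventually_ne hu] with x h0 h1 h2
    refine ⟨fun μ ν h => ?_, fun μ => by fin_cases μ <;> assumption⟩
    have h2' := sub_ne_zero.1 h2
    fin_cases μ <;> fin_cases ν <;> simp_all [xs, eq_comm]
  subset := subset_rfl
  contDiffAt _ _ μ := (hX μ).contDiffAt

end Solutions

/-! ### Cubic solutions. -/

section Polynomial

variable {X : Fin 2 → ℝ → ℝ} {s c₁ c₂ a A B : ℝ} {b q : Fin 2 → ℝ}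

theorem hasDerivAt_cubic (A B C E t : ℝ) :
    HasDerivAt (fun t => A * t ^ 3 + B * t ^ 2 + C * t + E) (3 * A * t ^ 2 + 2 * B * t + C) t := by
  have h := ((((hasDerivAt_id' t).pow 3).const_mul A).add
    (((hasDerivAt_id' t).pow 2).const_mul B)).add ((hasDerivAt_id' t).const_mul C)
  refine (h.add_const E).congr_deriv ?_
  norm_num
  ring

variable {κ Λ : ℝ} {C : Fin 2 → ℝ}

/-- For cubics with common leading coefficients the second-order part of `ricciOne` and `ricciTwo`
is `-3A/2 ± (C 0 - C 1) / (2 u²)`. Comparing powers of `u` gives `hA` and `hC`, and the `e⁰`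
equation gives `hκ`. The `u⁻⁴` terms and Maxwell's equation hold by the choice `c = -2√3`. -/
theorem isSugraSolution_cubic (hs : s * s = 1)
    (hX : ∀ μ t, X μ t = A * t ^ 3 + c₂ * t ^ 2 + C μ * t + b μ)
    (hA : A = s * Λ / 3) (hC : C 0 - C 1 = -8 * s * κ * (q 0 - q 1))
    (hκ : 12 * κ ^ 2 = -Λ) :
    IsSugraSolution s Λ (coframe X fun μ => quad κ a (q μ))
      (metricWithSign s X fun μ => quad κ a (q μ)) (gaugePotential (-2 * √3) q) (domain X) := by
  have hX' (μ : Fin 2) : X μ = fun t => A * t ^ 3 + c₂ * t ^ 2 + C μ * t + b μ := funext (hX μ)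
  have hD : RegularOn X (domain X) := regularOn_domain fun μ => by
    rw [hX']; fun_prop
  have hd (μ : Fin 2) : deriv (X μ) = fun t => 3 * A * t ^ 2 + 2 * c₂ * t + C μ := by
    funext t
    rw [hX', (hasDerivAt_cubic A c₂ (C μ) (b μ) t).deriv]
  have hdd (μ : Fin 2) : deriv (deriv (X μ)) = fun t => 2 * (3 * A) * t + 2 * c₂ := by
    funext t
    rw [hd, show (fun t => 3 * A * t ^ 2 + 2 * c₂ * t + C μ)
      = fun t => 0 * t ^ 3 + 3 * A * t ^ 2 + 2 * c₂ * t + C μ by funext t; ring,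
      (hasDerivAt_cubic _ _ _ _ t).deriv]
    ring
  have hC' : C 0 = C 1 - 8 * s * κ * (q 0 - q 1) := by linear_combination hC
  have hΛ : Λ = -12 * κ ^ 2 := by linear_combination hκ
  have h3 : √3 ^ 2 = 3 := Real.sq_sqrt (by norm_num)
  have hf (x y : ℝ) : fieldCoeff (-2 * √3) q x y ^ 2 = 12 * (q 0 - q 1) ^ 2 / (x - y) ^ 4 := by
    rw [fieldCoeff, div_pow, mul_pow, neg_mul, neg_neg, mul_pow, h3]
    ring
  refine isSugraSolution_of_scalar hs hD (fun p hp => ?_) (fun p hp => ?_) (fun p hp => ?_)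
    fun p hp => ?_
  · have hu := sub_ne_zero_of_mem_domain hp
    rw [ricciOne, hdd, hd, hd, hf, torsionOne, hC', hA, hΛ]
    field_simp
    ring
  · have hu := sub_ne_zero_of_mem_domain hp
    rw [ricciTwo, hdd, hd, hd, hf, torsionTwo, hC', hA, hΛ]
    field_simp
    ring
  · have hu := sub_ne_zero_of_mem_domain hp
    rw [ricciZero, hf, torsionOne, torsionTwo, hΛ]
    field_simp
    ring
  · have hu := sub_ne_zero_of_mem_domain hp
    rw [fieldCoeff, torsionOne, torsionTwo]
    field_simp
    ring

end Polynomial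

/-! ### From the field equations to ordinary differential equations. -/

section Converse

variable {X : Fin 2 → ℝ → ℝ} {D : Set (Coord 2 → ℝ)} {p : Coord 2 → ℝ} {c : ℝ} {q : Fin 2 → ℝ}

theorem scalar_of_isEuclideanSolution (hD : RegularOn X D)
    (h : IsEuclideanSolution (-12) (coframe X fun μ => quad 1 0 (q μ))
      (stMetric X fun μ => quad 1 0 (q μ)) (gaugePotential c q) D) (hp : p ∈ D) :
    (q 0 ≠ q 1 → c = -2 * √3)
      ∧ -(p (Sum.inl 0) - p (Sum.inl 1)) * deriv (deriv (X 0)) (p (Sum.inl 0))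
          + (deriv (X 0) (p (Sum.inl 0)) - deriv (X 1) (p (Sum.inl 1)))
        = 12 * (p (Sum.inl 0) - p (Sum.inl 1)) ^ 2 - 8 * (q 0 - q 1)
      ∧ (p (Sum.inl 0) - p (Sum.inl 1)) * deriv (deriv (X 1)) (p (Sum.inl 1))
          - (deriv (X 0) (p (Sum.inl 0)) - deriv (X 1) (p (Sum.inl 1)))
        = 12 * (p (Sum.inl 0) - p (Sum.inl 1)) ^ 2 + 8 * (q 0 - q 1) := by
  have hp' := hD.subset hp
  have hu := sub_ne_zero_of_mem_domain hp'
  have h0 := zero_ne_of_mem_domain hp'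
  have h1 := one_ne_of_mem_domain hp'
  have hs : (1 : ℝ) * 1 = 1 := one_mul 1
  have E := h.einstein p hp
  -- On these indices the `4`-form `dx ∧ θ₁ ∧ dy ∧ θ₂` is `± (x - y)`, hence nonzero.
  have M := h.maxwell p hp ![Sum.inl 0, Sum.inr 1, Sum.inl 1, Sum.inr 2]
  rw [maxwell_fieldStrength hs hD hp] at M
  simp only [ricci_eq hs hD hp, metric_eq, contr_fieldStrength 1 0 hs hp',
    normSq_fieldStrength 1 0 hs hp'] at E
  have E0 := E (Sum.inl 0) (Sum.inl 0)
  have E1 := E (Sum.inl 1) (Sum.inl 1)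
  -- Only `phi` has a `dψ₀` component, so this entry isolates the `e⁰` equation.
  have E2 := E (Sum.inr 0) (Sum.inr 0)
  simp [dx, ext, wedge, wedgeOne] at E0 E1 E2 M
  generalize p (Sum.inl 0) = x at *
  generalize p (Sum.inl 1) = y at *
  clear h hp hD E
  have hk : (x - y) / X 0 x ≠ 0 := div_ne_zero hu h0
  have hl : (y - x) / X 1 y ≠ 0 := div_ne_zero (fun h => hu (by linear_combination -h)) h1
  have R0 : ricciZero 1 q x y = 4 + fieldCoeff c q x y ^ 2 / 3 := by
    simp [thetaForm, phi] at E2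
    linear_combination E2 / 4
  have R1 : ricciOne 1 1 q X x y = 4 - fieldCoeff c q x y ^ 2 / 6 := by
    refine mul_right_cancel₀ hk ?_
    linear_combination E0
  have R2 : ricciTwo 1 1 q X x y = 4 - fieldCoeff c q x y ^ 2 / 6 := by
    refine mul_right_cancel₀ hl ?_
    linear_combination E1
  -- Kept in this form because it also holds when `q 0 = q 1`, where `F = 0` and `c` is free. It
  -- removes `c`, and then the `u⁻⁴` terms, from the other two equations.
  have hc : c ^ 2 * (q 0 - q 1) ^ 2 = 12 * (q 0 - q 1) ^ 2 := by
    simp only [ricciZero, torsionOne, torsionTwo, fieldCoeff] at R0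
    field_simp at R0
    linear_combination -R0
  have hf : fieldCoeff c q x y ^ 2 = 12 * (q 0 - q 1) ^ 2 / (x - y) ^ 4 := by
    rw [← hc, fieldCoeff]
    field_simp
  rw [hf] at R1 R2
  refine ⟨fun hq => ?_, ?_, ?_⟩
  · have hδ : q 0 - q 1 ≠ 0 := sub_ne_zero.2 hq
    -- Einstein's equation is even in `c`; the sign comes from Maxwell's equation.
    have hM : 2 / √3 * fieldCoeff c q x y ^ 2
        - 2 * fieldCoeff c q x y * (torsionTwo 1 q x y - torsionOne 1 q x y) = 0 := by
      refine M.resolve_right fun h => hu ?_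
      simpa [thetaForm, sub_eq_add_neg] using h
    have hc0 : c ≠ 0 := by
      rintro rfl
      have : (q 0 - q 1) ^ 2 = 0 := by linear_combination -hc / 12
      exact hδ (pow_eq_zero_iff two_ne_zero |>.1 this)
    have h3 : √3 ≠ 0 := by positivity
    simp only [fieldCoeff, torsionOne, torsionTwo] at hM
    field_simp at hM
    have : (2 * c * (q 0 - q 1) ^ 2) * (c + 2 * √3) = 0 := by linear_combination hM
    have := (mul_eq_zero.1 this).resolve_left (by positivity)
    linear_combination this
  · simp only [ricciOne, torsionOne] at R1
    field_simp at R1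
    have : (x - y) ^ 2 * (-(x - y) * deriv (deriv (X 0)) x + (deriv (X 0) x - deriv (X 1) y)
      - (12 * (x - y) ^ 2 - 8 * (q 0 - q 1))) = 0 := by linear_combination R1 / 6
    have := (mul_eq_zero.1 this).resolve_left (pow_ne_zero 2 hu)
    linear_combination this
  · simp only [ricciTwo, torsionTwo] at R2
    field_simp at R2
    have : (x - y) ^ 2 * ((x - y) * deriv (deriv (X 1)) y - (deriv (X 0) x - deriv (X 1) y)
      - (12 * (x - y) ^ 2 + 8 * (q 0 - q 1))) = 0 := by linear_combination R2 / 6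
    have := (mul_eq_zero.1 this).resolve_left (pow_ne_zero 2 hu)
    linear_combination this

end Converse

/-! ### Integration of the second-order equation. -/

section Integration

theorem cubic_of_second_derivative {J : Set ℝ} (hJ : IsOpen J) (hJ' : J.OrdConnected)
    {f : ℝ → ℝ} {k t₀ : ℝ} (h₀ : t₀ ∈ J) (hf : ContDiffOn ℝ 2 f J)
    (h : ∀ t ∈ J, deriv (deriv f) t + 24 * t = 2 * k) :
    ∃ l b : ℝ, (∀ t ∈ J, f t = -4 * t ^ 3 + k * t ^ 2 + l * t + b)
      ∧ ∀ t ∈ J, deriv f t = -12 * t ^ 2 + 2 * k * t + l := by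
  have hc : IsPreconnected J := hJ'.isPreconnected
  have hd (t : ℝ) (ht : t ∈ J) : DifferentiableAt ℝ f t :=
    (hf.contDiffAt (hJ.mem_nhds ht)).differentiableAt (by norm_num)
  have hd' (t : ℝ) (ht : t ∈ J) : DifferentiableAt ℝ (deriv f) t := by
    have h1 : ContDiffAt ℝ 1 (deriv f) t :=
      (hf.contDiffAt (hJ.mem_nhds ht)).derivWithin (m := 1) (n := 2) (by norm_num)
    exact h1.differentiableAt (by norm_num)
  have hconst {F : ℝ → ℝ} (hF : ∀ t ∈ J, HasDerivAt F 0 t) : ∀ t ∈ J, F t = F t₀ :=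
    fun t ht => hJ.is_const_of_deriv_eq_zero hc
      (fun t ht => (hF t ht).differentiableAt.differentiableWithinAt)
      (fun t ht => (hF t ht).deriv) ht h₀
  obtain ⟨l, hl⟩ : ∃ l, ∀ t ∈ J, deriv f t = -12 * t ^ 2 + 2 * k * t + l := by
    refine ⟨deriv f t₀ + 12 * t₀ ^ 2 - 2 * k * t₀, fun t ht => ?_⟩
    -- The zero coefficients put the quadratic in the shape of `hasDerivAt_cubic`.
    have := hconst (F := fun t => deriv f t - (0 * t ^ 3 + -12 * t ^ 2 + 2 * k * t + 0))
      (fun t ht => ((hd' t ht).hasDerivAt.sub (hasDerivAt_cubic _ _ _ _ t)).congr_deriv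
        (by linear_combination h t ht)) t ht
    linear_combination this
  refine ⟨l, f t₀ + 4 * t₀ ^ 3 - k * t₀ ^ 2 - l * t₀, fun t ht => ?_, hl⟩
  have := hconst (F := fun t => f t - (-4 * t ^ 3 + k * t ^ 2 + l * t + 0))
    (fun t ht => ((hd t ht).hasDerivAt.sub (hasDerivAt_cubic _ _ _ _ t)).congr_deriv
      (by linear_combination hl t ht)) t ht
  linear_combination this

end Integration

/-! ### Separation of variables. -/

section Converse

variable {c : ℝ} {q : Fin 2 → ℝ} {X : Fin 2 → ℝ → ℝ} {J : Fin 2 → Set ℝ}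

theorem cubic_of_isEuclideanSolution
    (hJ : ∀ μ, IsOpen (J μ) ∧ (J μ).OrdConnected ∧ (J μ).Nonempty ∧ ContDiffOn ℝ 2 (X μ) (J μ))
    (hD : {p : Coord 2 → ℝ | ∀ μ, xs p μ ∈ J μ} ⊆ domain X)
    (h : IsEuclideanSolution (-12) (coframe X fun μ => quad 1 0 (q μ))
      (stMetric X fun μ => quad 1 0 (q μ)) (gaugePotential c q)
      {p : Coord 2 → ℝ | ∀ μ, xs p μ ∈ J μ}) :
    (∃ (c₁ c₂ : ℝ) (b : Fin 2 → ℝ), ∀ μ, ∀ t ∈ J μ,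
        X μ t = -4 * t ^ 3 + c₂ * t ^ 2 + c₁ * t + b μ - 8 * q μ * t) ∧
      (q 0 ≠ q 1 → c = -2 * √3) := by
  have hR : RegularOn X {p : Coord 2 → ℝ | ∀ μ, xs p μ ∈ J μ} :=
    ⟨h.isOpen, hD, fun p hp μ => (hJ μ).2.2.2.contDiffAt ((hJ μ).1.mem_nhds (hp μ))⟩
  have key (x y : ℝ) (hx : x ∈ J 0) (hy : y ∈ J 1) :
      x - y ≠ 0 ∧ (q 0 ≠ q 1 → c = -2 * √3)
      ∧ -(x - y) * deriv (deriv (X 0)) x + (deriv (X 0) x - deriv (X 1) y)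
        = 12 * (x - y) ^ 2 - 8 * (q 0 - q 1)
      ∧ (x - y) * deriv (deriv (X 1)) y - (deriv (X 0) x - deriv (X 1) y)
        = 12 * (x - y) ^ 2 + 8 * (q 0 - q 1) := by
    -- The `ψ` coordinates are unconstrained, so the slice `ψ = 0` carries all the information.
    have hp : (Sum.elim ![x, y] fun _ => 0 : Coord 2 → ℝ)
        ∈ {p : Coord 2 → ℝ | ∀ μ, xs p μ ∈ J μ} := by
      intro μ
      fin_cases μ <;> simpa [xs]
    exact ⟨sub_ne_zero_of_mem_domain (hD hp), scalar_of_isEuclideanSolution hR h hp⟩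
  obtain ⟨x₀, hx₀⟩ := (hJ 0).2.2.1
  obtain ⟨y₀, hy₀⟩ := (hJ 1).2.2.1
  -- Adding the two equations cancels the first derivatives and `q`, and a factor `x - y` divides
  -- out.
  have hdd (x y : ℝ) (hx : x ∈ J 0) (hy : y ∈ J 1) :
      deriv (deriv (X 0)) x + 24 * x = deriv (deriv (X 1)) y + 24 * y := by
    obtain ⟨hu, -, e₀, e₁⟩ := key x y hx hy
    refine mul_left_cancel₀ hu ?_
    linear_combination -(e₀ + e₁)
  set k := (deriv (deriv (X 1)) y₀ + 24 * y₀) / 2 with hk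
  obtain ⟨l, b, hX, hX'⟩ := cubic_of_second_derivative (k := k) (hJ 0).1 (hJ 0).2.1 hx₀
    (hJ 0).2.2.2 fun t ht => by rw [hdd t y₀ ht hy₀, hk]; ring
  obtain ⟨m, d, hY, hY'⟩ := cubic_of_second_derivative (k := k) (hJ 1).1 (hJ 1).2.1 hy₀
    (hJ 1).2.2.2 fun t ht => by rw [← hdd x₀ t hx₀ ht, hdd x₀ y₀ hx₀ hy₀, hk]; ring
  obtain ⟨-, hc, -, e⟩ := key x₀ y₀ hx₀ hy₀
  -- With both cubics known, one equation at one point fixes the difference of the linear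
  -- coefficients.
  have hlm : l - m = -8 * (q 0 - q 1) := by
    have h2 : deriv (deriv (X 1)) y₀ = 2 * k - 24 * y₀ := by rw [hk]; ring
    rw [hX' x₀ hx₀, hY' y₀ hy₀, h2] at e
    linear_combination -e
  -- By `hlm`, `l + 8 * q 0 = m + 8 * q 1`, so this value of `c₁` serves both indices.
  refine ⟨⟨l + 8 * q 0, k, ![b, d], fun μ t ht => ?_⟩, hc⟩
  fin_cases μ
  · have := hX t ht
    simp
    linear_combination this
  · have := hY t ht
    simp
    linear_combination this - t * hlm

end Converse

end STSugra

end

open STSugra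
theorem mainTheorem8 :
    -- the Euclidean solutions of the gauged theory
    (∀ (c₁ c₂ : ℝ) (b q : Fin 2 → ℝ) (X N : Fin 2 → ℝ → ℝ),
      (∀ μ t, X μ t = -4 * t ^ 3 + c₂ * t ^ 2 + c₁ * t + b μ - 8 * q μ * t) →
      (∀ μ t, N μ t = q μ) →
      IsEuclideanSolution (-12) (coframe X N) (stMetric X N)
        (gaugePotential (-2 * √3) q) (domain X)) ∧
    -- the field equations force this form of `X_μ` and this value of `c_F`
    (∀ (cF : ℝ) (q : Fin 2 → ℝ) (X N : Fin 2 → ℝ → ℝ) (J : Fin 2 → Set ℝ),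
      (∀ μ t, N μ t = q μ) →
      (∀ μ, IsOpen (J μ) ∧ (J μ).OrdConnected ∧ (J μ).Nonempty ∧
        ContDiffOn ℝ 2 (X μ) (J μ)) →
      {p : Coord 2 → ℝ | ∀ μ, xs p μ ∈ J μ} ⊆ domain X →
      IsEuclideanSolution (-12) (coframe X N) (stMetric X N) (gaugePotential cF q)
        {p : Coord 2 → ℝ | ∀ μ, xs p μ ∈ J μ} →
      (∃ (c₁ c₂ : ℝ) (b : Fin 2 → ℝ), ∀ μ, ∀ t ∈ J μ,
        X μ t = -4 * t ^ 3 + c₂ * t ^ 2 + c₁ * t + b μ - 8 * q μ * t) ∧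
      (q 0 ≠ q 1 → cF = -2 * √3)) ∧
    -- the Euclidean solutions of the ungauged theory
    (∀ (c₁ c₂ a₁ : ℝ) (b q : Fin 2 → ℝ) (X N : Fin 2 → ℝ → ℝ),
      (∀ μ t, X μ t = c₂ * t ^ 2 + c₁ * t + b μ) →
      (∀ μ t, N μ t = -t ^ 2 + a₁ * t + q μ) →
      IsEuclideanSolution 0 (coframe X N) (stMetric X N)
        (gaugePotential (-2 * √3) q) (domain X)) ∧
    -- the Lorentzian solutions of the gauged theory
    (∀ (c₁ c₂ : ℝ) (b q : Fin 2 → ℝ) (X N : Fin 2 → ℝ → ℝ),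
      (∀ μ t, X μ t = 4 * t ^ 3 + c₂ * t ^ 2 + c₁ * t + b μ + 8 * q μ * t) →
      (∀ μ t, N μ t = q μ) →
      IsLorentzianSolution (-12) (coframe X N) (lorentzMetric X N)
        (gaugePotential (-2 * √3) q) (domain X)) ∧
    -- the Lorentzian solutions of the ungauged theory
    (∀ (c₁ c₂ a₁ : ℝ) (b q : Fin 2 → ℝ) (X N : Fin 2 → ℝ → ℝ),
      (∀ μ t, X μ t = c₂ * t ^ 2 + c₁ * t + b μ) →
      (∀ μ t, N μ t = -t ^ 2 + a₁ * t + q μ) →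
      IsLorentzianSolution 0 (coframe X N) (lorentzMetric X N)
        (gaugePotential (-2 * √3) q) (domain X)) := by
  have hN₁ {q : Fin 2 → ℝ} {N : Fin 2 → ℝ → ℝ} (h : ∀ μ t, N μ t = q μ) :
      N = fun μ => quad 1 0 (q μ) := by
    funext μ t; rw [h, quad]; ring
  have hN₀ {a₁ : ℝ} {q : Fin 2 → ℝ} {N : Fin 2 → ℝ → ℝ}
      (h : ∀ μ t, N μ t = -t ^ 2 + a₁ * t + q μ) : N = fun μ => quad 0 a₁ (q μ) := by
    funext μ t; rw [h, quad]; ring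
  refine ⟨fun c₁ c₂ b q X N hX hN => ?_, fun cF q X N J hN hJ hD h => ?_,
    fun c₁ c₂ a₁ b q X N hX hN => ?_, fun c₁ c₂ b q X N hX hN => ?_,
    fun c₁ c₂ a₁ b q X N hX hN => ?_⟩
  · rw [hN₁ hN]
    exact isSugraSolution_cubic (A := -4) (c₂ := c₂) (C := fun μ => c₁ - 8 * q μ) (b := b)
      (by norm_num) (fun μ t => by rw [hX]; ring) (by norm_num) (by ring) (by norm_num)
  · rw [hN₁ hN] at h
    exact cubic_of_isEuclideanSolution hJ hD h
  · rw [hN₀ hN]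
    exact isSugraSolution_cubic (A := 0) (c₂ := c₂) (C := fun _ => c₁) (b := b)
      (by norm_num) (fun μ t => by rw [hX]; ring) (by norm_num) (by ring) (by norm_num)
  · rw [hN₁ hN]
    exact isSugraSolution_cubic (A := 4) (c₂ := c₂) (C := fun μ => c₁ + 8 * q μ) (b := b)
      (by norm_num) (fun μ t => by rw [hX]; ring) (by norm_num) (by ring) (by norm_num)
  · rw [hN₀ hN]
    exact isSugraSolution_cubic (A := 0) (c₂ := c₂) (C := fun _ => c₁) (b := b)
      (by norm_num) (fun μ t => by rw [hX]; ring) (by norm_num) (by ring) (by norm_num)
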